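/- Let $K\ge 1$, $\alpha>0$. Book shapes are vectors $q=(q_{-K},\dots,q_{-1},q_1,\dots,q_K)\in\mathbb Z^{2K}$; put $i_{bb}(q)=\max(-K-1,\sup\{i:q_i<0\})$, $i_{ba}(q)=\min(K+1,\inf\{i:q_i>0\})$, and let $\Omega$ be the set of $q$ with $q_i\le 0$ for $i\le i_{bb}(q)$ and $q_i\ge 0$ for $i\ge i_{ba}(q)$. Let $f_i,g_i:\Omega\times\mathbb N^+\to\mathbb R_+$ and $u,d:\Omega\to\mathbb R_+$ be rates, $\theta\in[0,1]$, $\pi^{inc},\pi^{dec}$ probability measures on $\Omega$ and $\pi_K,\pi_{-K}$ probability measures on $\mathbb Z$. Write $[q^+,l]=(q_{-K+1},\dots,q_K,l)$ and $[l,q^-]=(l,q_{-K},\dots,q_{K-1})$. Let $X(t)=(q(t),p_{ref}(t))$ be the Markov jump process on $\Omega\times\alpha(\tfrac12+\mathbb Z)$ which jumps from $(q,p)$ - to $(q+ne_i,p)$ at rate $f_i(q,n)$ and to $(q-ne_i,p)$ at rate $g_i(q,n)$ ($n\ge1$); - to $(q',p+\alpha)$ at rate $u(q)\big[(1-\theta)\sum_{l:[q^+,l]=q'}\pi_K(l)+\theta\,\pi^{inc}(q')\big]$,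 and to $(q',p-\alpha)$ at rate $d(q)\big[(1-\theta)\sum_{l:[l,q^-]=q'}\pi_{-K}(l)+\theta\,\pi^{dec}(q')\big]$; and has no other jumps. Here $f_i(q,n)=0$ (resp. $g_i(q,n)=0$) if $q+ne_i\notin\Omega$ (resp. $q-ne_i\notin\Omega$), and the price jump rates above, summed over $q'\in\Omega$, equal $u(q)$ and $d(q)$. With $0/0=0$ let $$f_i^*(q)=\sum_n f_i(q,n)<\infty,\quad g_i^*(q)=\sum_n g_i(q,n)<\infty,\quad \Lambda(q)=\sum_i\big(f_i^*(q)+g_i^*(q)\big),\quad a_i^*=\frac{f_i^*}{\Lambda},\quad b_i^*=\frac{g_i^*}{\Lambda},$$ $$G^{f,i,q}(z)=\sum_{n\ge1} z^n\frac{f_i(q,n)}{f_i^*(q)},\qquad G^{g,i,q}(z)=\sum_{n\ge1} z^n\frac{g_i(q,n)}{g_i^*(q)},$$ and suppose $\Lambda(q)>0$ for all $q\in\Omega$. Assume: 1. $X$ is irreducible and its embedded chain is aperiodic. 2. For $i\ge i_{ba}(q)$, $g_i(q,n)=0$ for all $n>q_i$; for $i\le i_{bb}(q)$, $f_i(q,n)=0$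 for all $n>-q_i$. 3. There is $z^*>1$ with $G^{f,i,q}(z^*)<\infty$ and $G^{g,i,q}(z^*)<\infty$ for all $q,i$, and there is $L>0$ such that for all $i$ $$\varlimsup_{z\to1^+}\sup_q\big[f_i^*(q)G^{f,i,q}(z)\mathbf 1_{i>i_{bb}(q)}+g_i^*(q)G^{g,i,q}(z)\mathbf 1_{i<i_{ba}(q)}\big]<L;$$ the same holds, for some $L>0$, with $a_i^*,b_i^*$ in place of the factors $f_i^*,g_i^*$. 4. There are $r>0$ and $U>1$ such that $$\varlimsup_{z\to1^+}\ \sup_{(q,i):\,q_i>U,\,i\ge i_{ba}(q)}\Big[a_i^*(q)-b_i^*(q)\frac{1-G^{g,i,q}(z^{-1})}{G^{f,i,q}(z)-1}\Big]<-r,$$ $$\varlimsup_{z\to1^+}\ \sup_{(q,i):\,q_i<-U,\,i\le i_{bb}(q)}\Big[b_i^*(q)-a_i^*(q)\frac{1-G^{f,i,q}(z^{-1})}{G^{g,i,q}(z)-1}\Big]<-r.$$ 5. With the same $U$, for every $z>1$, $$\inf_{(q,i):\,q_i>U,\,i\ge i_{ba}(q)}\big(G^{f,i,q}(z)-1\big)>0,\qquad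 \inf_{(q,i):\,q_i<-U,\,i\le i_{bb}(q)}\big(G^{g,i,q}(z)-1\big)>0.$$ 6. With the same $U$, there is $z>1$ such that $\mathbb E\big[\sum_i z^{|Q_i|-U}\big]<\infty$ for $Q\sim\pi^{inc}$ and for $Q\sim\pi^{dec}$, and $\mathbb E[z^{|Q|-U}]<\infty$ for $Q\sim\pi_K$ and for $Q\sim\pi_{-K}$. 7. There is a finite set $W\subset\Omega$ with $$\sup_{q\in\Omega\setminus W}\frac{u(q)+d(q)}{\Lambda(q)+u(q)+d(q)}<1.$$ Let $q(n)$ and $p_{ref}(n)$ be the shape and the reference price after the $n$-th jump of $X$, $c(n)=p_{ref}(n)-p_{ref}(n-1)$ for $n\ge 1$, and let $c(0)\in\{-\alpha,0,\alpha\}$ be arbitrary. Then the Markov chain $Y(n)=(q(n),c(n))$ on $\Omega\times\{-\alpha,0,\alpha\}$ is - $V$-uniformly ergodic: there are a function $V>1$ with $V(x)\to\infty$ as $\|x\|\to\infty$, an invariant distribution $\pi$, $\rho\in(0,1)$ and $R<\infty$ with $\|P^n(x,\cdot)-\pi\|_V\le R\rho^nV(x)$ for all states $x$ and all $n\ge0$,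 where $\|\mu\|_V=\sup_{|h|\le V}|\mu(h)|$ and $P$ is the transition kernel of $Y$; - positive Harris recurrent: it has an invariant probability measure, and there is a non-zero $\sigma$-finite measure $\varphi$ such that every set $A$ with $\varphi(A)>0$ is visited infinitely often almost surely from every initial state. -/

import Mathlib

open MeasureTheory ProbabilityTheory Filter Topology
open scoped NNReal ENNReal

noncomputable section

/-! ### Discrete-time Markov chains on a countable state space -/

section MarkovChains

variable {S : Type*}

/-- The law of the chain after `n` steps from `x`, when one step from `x` has law `P x`. -/
def stepLaw (P : S → PMF S) : ℕ → S → PMF S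
  | 0, x => PMF.pure x
  | n + 1, x => (P x).bind (stepLaw P n)

/-- Every state leads to every state. -/
def ChainIrreducible (P : S → PMF S) : Prop :=
  ∀ x y, ∃ n, stepLaw P n x y ≠ 0

/-- For every state, the possible return times have greatest common divisor one. -/
def ChainAperiodic (P : S → PMF S) : Prop :=
  ∀ (x : S) (d : ℕ), (∀ n, 0 < n → stepLaw P n x x ≠ 0 → d ∣ n) → d = 1

/-- `π` is an invariant distribution of the chain. -/
def IsInvariantLaw (P : S → PMF S) (π : PMF S) : Prop :=
  π.bind P = π

/-- The transition kernel of the chain; `S` carries the discrete σ-algebra. -/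
def chainKernel (P : S → PMF S) : @Kernel S S ⊤ ⊤ :=
  letI : MeasurableSpace S := ⊤
  { toFun := fun x => (P x).toMeasure
    measurable' := measurable_from_top }

theorem isMarkovKernel_chainKernel (P : S → PMF S) :
    letI : MeasurableSpace S := ⊤
    IsMarkovKernel (chainKernel P) := by
  let _ : MeasurableSpace S := ⊤
  exact ⟨fun x => PMF.toMeasure.isProbabilityMeasure (P x)⟩

/-- The law on path space of the chain started at `x` (Ionescu-Tulcea). -/
def pathLaw (P : S → PMF S) (x : S) : @Measure (ℕ → S) (@MeasurableSpace.pi ℕ _ (fun _ => ⊤)) :=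
  letI : MeasurableSpace S := ⊤
  haveI := isMarkovKernel_chainKernel P
  Kernel.trajMeasure (X := fun _ : ℕ => S) (Measure.dirac x)
    (fun n => (chainKernel P).comap
      (fun h : (i : Finset.Iic n) → S => h ⟨n, Finset.mem_Iic.2 le_rfl⟩)
      (measurable_pi_apply _))

/-- Harris recurrence: for some non-zero σ-finite measure `φ`, every set charged by `φ` is
visited infinitely often, almost surely, from every starting state. -/
def IsHarrisRecurrent (P : S → PMF S) : Prop :=
  letI : MeasurableSpace S := ⊤
  ∃ φ : Measure S, SigmaFinite φ ∧ φ ≠ 0 ∧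
    ∀ A : Set S, 0 < φ A → ∀ x, ∀ᵐ ω ∂(pathLaw P x), ∃ᶠ n in atTop, ω n ∈ A

/-- Positive Harris recurrence: Harris recurrence and an invariant probability. -/
def IsPositiveHarrisRecurrent (P : S → PMF S) : Prop :=
  IsHarrisRecurrent P ∧ ∃ π : PMF S, IsInvariantLaw P π

/-- The `V`-norm of the signed measure `μ - ν`, that is the supremum of
`|∫ g d(μ - ν)|` over `|g| ≤ V`, which on a countable space is `∑ y, V y * |μ y - ν y|`. -/
def vDist (V : S → ℝ) (μ ν : PMF S) : ℝ≥0∞ :=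
  ∑' y, ENNReal.ofReal (V y * |(μ y).toReal - (ν y).toReal|)

/-- `V`-uniform ergodicity, for a state space on which `size` is the norm that defines
coercivity of `V`. -/
def IsVUniformlyErgodic (size : S → ℝ) (P : S → PMF S) : Prop :=
  ∃ V : S → ℝ, (∀ x, 1 < V x) ∧ Tendsto V (comap size atTop) atTop ∧
    ∃ π : PMF S, IsInvariantLaw P π ∧
      ∃ r : ℝ, 0 < r ∧ r < 1 ∧ ∃ R : ℝ, ∀ (x : S) (n : ℕ),
        vDist V (stepLaw P n x) π ≤ ENNReal.ofReal (R * r ^ n * V x)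

end MarkovChains

/-! ### Shapes of the order book

A shape is a vector indexed by `Fin (2 * K)`: the positions `0, …, K - 1, K, …, 2 * K - 1` stand,
in this order, for the limits `Q_{-K}, …, Q_{-1}, Q_1, …, Q_K`. -/

/-- Position of the best bid (`⊥` if there is no bid order). -/
def bestBid {K : ℕ} (q : Fin (2 * K) → ℤ) : WithBot (Fin (2 * K)) :=
  (Finset.univ.filter (fun i => q i < 0)).max

/-- Position of the best ask (`⊤` if there is no ask order). -/
def bestAsk {K : ℕ} (q : Fin (2 * K) → ℤ) : WithTop (Fin (2 * K)) :=
  (Finset.univ.filter (fun i => 0 < q i)).min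

/-- The state space `Ω` of the order book shape. -/
def Book (K : ℕ) : Type :=
  {q : Fin (2 * K) → ℤ // ∀ i : Fin (2 * K),
    ((i : WithBot (Fin (2 * K))) ≤ bestBid q → q i ≤ 0) ∧
    (bestAsk q ≤ (i : WithTop (Fin (2 * K))) → 0 ≤ q i)}

/-- `[q⁺, l]`: the limits move one position to the left and `l` enters at `Q_K`. -/
def shiftUp {K : ℕ} (q : Fin (2 * K) → ℤ) (l : ℤ) : Fin (2 * K) → ℤ :=
  fun i => if h : (i : ℕ) + 1 < 2 * K then q ⟨(i : ℕ) + 1, h⟩ else l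

/-- `[l, q⁻]`: the limits move one position to the right and `l` enters at `Q_{-K}`. -/
def shiftDown {K : ℕ} (l : ℤ) (q : Fin (2 * K) → ℤ) : Fin (2 * K) → ℤ :=
  fun i => if (i : ℕ) = 0 then l else q ⟨(i : ℕ) - 1, lt_of_le_of_lt (Nat.sub_le _ _) i.2⟩

/-- The grid `α (1/2 + ℤ)` of reference prices. -/
def Price (α : ℝ) : Type := {p : ℝ // ∃ k : ℤ, p = α * (1 / 2 + k)}

/-- The possible reference price increments `-α, 0, α` at one event. -/
def Increment (α : ℝ) : Type := {c : ℝ // c = -α ∨ c = 0 ∨ c = α}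

/-! ### The model -/

/-- The parameters of the model, on `K` limits on each side. -/
structure OrderBook (K : ℕ) where
  /-- tick size -/
  α : ℝ
  /-- `f i q n`: rate of `q → q + n e_i` -/
  f : Fin (2 * K) → Book K → ℕ+ → ℝ≥0
  /-- `g i q n`: rate of `q → q - n e_i` -/
  g : Fin (2 * K) → Book K → ℕ+ → ℝ≥0
  /-- rate of upward jumps of the reference price -/
  u : Book K → ℝ≥0
  /-- rate of downward jumps of the reference price -/
  d : Book K → ℝ≥0
  /-- reinitialization probability -/
  θ : ℝ≥0
  /-- reinitialization law after an upward price jump -/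
  πinc : PMF (Book K)
  /-- reinitialization law after a downward price jump -/
  πdec : PMF (Book K)
  /-- boundary law at `Q_K` -/
  πK : PMF ℤ
  /-- boundary law at `Q_{-K}` -/
  πmK : PMF ℤ

namespace OrderBook

variable {K : ℕ} (M : OrderBook K)

/-- States `(q, p_ref)` of the process `X`. -/
abbrev XState : Type := Book K × Price M.α

/-- States `(q, c)` of the chain `Y`. -/
abbrev YState : Type := Book K × Increment M.α

open Classical in
/-- Rate of pure order book jumps from `q` to `q'`. -/
def pureRate (q q' : Book K) : ℝ≥0∞ :=
  ∑ i : Fin (2 * K), ∑' n : ℕ+,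
    ((if q'.1 = q.1 + Pi.single i ((n : ℕ) : ℤ) then (M.f i q n : ℝ≥0∞) else 0) +
     (if q'.1 = q.1 - Pi.single i ((n : ℕ) : ℤ) then (M.g i q n : ℝ≥0∞) else 0))

open Classical in
/-- Rate of the common jumps from `(q, p)` to `(q', p + α)`. -/
def upRate (q q' : Book K) : ℝ≥0∞ :=
  ((1 - M.θ : ℝ≥0) : ℝ≥0∞) * M.u q * (∑' l : ℤ, if q'.1 = shiftUp q.1 l then M.πK l else 0)
    + (M.θ : ℝ≥0∞) * M.u q * M.πinc q'

open Classical in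
/-- Rate of the common jumps from `(q, p)` to `(q', p - α)`. -/
def downRate (q q' : Book K) : ℝ≥0∞ :=
  ((1 - M.θ : ℝ≥0) : ℝ≥0∞) * M.d q * (∑' l : ℤ, if q'.1 = shiftDown l q.1 then M.πmK l else 0)
    + (M.θ : ℝ≥0∞) * M.d q * M.πdec q'

open Classical in
/-- The off-diagonal entries of the infinitesimal generator of `X`. -/
def jumpRate (x y : M.XState) : ℝ≥0∞ :=
  if x = y then 0 else
    (if y.2.1 = x.2.1 then M.pureRate x.1 y.1 else 0) +
    (if y.2.1 = x.2.1 + M.α then M.upRate x.1 y.1 else 0) +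
    (if y.2.1 = x.2.1 - M.α then M.downRate x.1 y.1 else 0)

/-- The total jump rate of `X` out of `x`: minus the diagonal entry of the generator. -/
abbrev exitRate (x : M.XState) : ℝ≥0∞ := ∑' y, M.jumpRate x y

open Classical in
/-- One step of the embedded jump chain of `X`: from `x` to `y` with probability
`jumpRate x y / exitRate x` (the chain stays put in an absorbing state). -/
def jumpChain (x : M.XState) : PMF M.XState :=
  if h : M.exitRate x ≠ 0 ∧ M.exitRate x ≠ ∞ then PMF.normalize (M.jumpRate x) h.1 h.2
  else PMF.pure x

open Classical in
/-- The price increment between two successive reference prices (one tick at most). -/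
def increment {α : ℝ} (p p' : Price α) : Increment α :=
  if p'.1 - p.1 = α then ⟨α, Or.inr (Or.inr rfl)⟩
  else if p'.1 - p.1 = -α then ⟨-α, Or.inl rfl⟩
  else ⟨0, Or.inr (Or.inl rfl)⟩

/-- The price `α / 2`. -/
def basePrice (α : ℝ) : Price α := ⟨α * (1 / 2 + (0 : ℤ)), 0, rfl⟩

/-- The law of `(q(n+1), p_ref(n+1) - p_ref(n))` when `(q(n), p_ref(n)) = (q, p)`. -/
def eventLaw (q : Book K) (p : Price M.α) : PMF M.YState :=
  (M.jumpChain (q, p)).map (fun y => (y.1, increment p y.2))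

/-- One step of the chain `Y(n) = (q(n), c(n))`. The reference price from which the event is
seen is irrelevant, see `eventLaw_eq`. -/
def Ychain (x : M.YState) : PMF M.YState := M.eventLaw x.1 (basePrice M.α)

/-- Translation of the price grid that moves `p` to `p'`. -/
def translate {α : ℝ} (p p' : Price α) : Price α ≃ Price α where
  toFun r := ⟨r.1 + (p'.1 - p.1), by
    obtain ⟨a, ha⟩ := r.2
    obtain ⟨b, hb⟩ := p.2
    obtain ⟨c, hc⟩ := p'.2
    exact ⟨a + (c - b), by rw [ha, hb, hc]; push_cast; ring⟩⟩
  invFun r := ⟨r.1 - (p'.1 - p.1), by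
    obtain ⟨a, ha⟩ := r.2
    obtain ⟨b, hb⟩ := p.2
    obtain ⟨c, hc⟩ := p'.2
    exact ⟨a - (c - b), by rw [ha, hb, hc]; push_cast; ring⟩⟩
  left_inv r := Subtype.ext (by simp)
  right_inv r := Subtype.ext (by simp)

theorem translate_val {α : ℝ} (p p' r : Price α) :
    (translate p p' r).1 = r.1 + (p'.1 - p.1) := rfl

theorem jumpRate_translate (q : Book K) (p p' : Price M.α) (y : M.XState) :
    M.jumpRate (q, p') (y.1, translate p p' y.2) = M.jumpRate (q, p) y := by
  obtain ⟨q', r⟩ := y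
  have h0 : translate p p' p = p' := Subtype.ext (by rw [translate_val]; ring)
  have h1 : ((q, p') = (q', translate p p' r)) ↔ ((q, p) = (q', r)) := by
    rw [Prod.mk.injEq, Prod.mk.injEq]
    refine and_congr_right fun _ => ?_
    conv_lhs => rw [← h0]
    simp only [h0]
    rw [show (p' = translate p p' r) ↔ (translate p p' p = translate p p' r) by rw [h0]]
    exact (translate p p').injective.eq_iff
  have h2 (a : ℝ) : ((translate p p' r).1 = p'.1 + a) ↔ (r.1 = p.1 + a) := by
    rw [translate_val]
    constructor <;> intro h <;> linarith
  have h3 := h2 0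
  have h4 := h2 (-M.α)
  simp only [add_zero, ← sub_eq_add_neg] at h3 h4
  unfold jumpRate
  by_cases hq : (q, p) = (q', r)
  · rw [if_pos hq, if_pos (h1.2 hq)]
  · rw [if_neg hq, if_neg (fun h => hq (h1.1 h))]
    simp only [h2, h3, h4]

theorem eventLaw_eq (q : Book K) (p p' : Price M.α) : M.eventLaw q p' = M.eventLaw q p := by
  let e : M.XState ≃ M.XState := (Equiv.refl _).prodCongr (translate p p')
  have hr : ∀ y, M.jumpRate (q, p') (e y) = M.jumpRate (q, p) y :=
    fun y => M.jumpRate_translate q p p' y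
  have hx : M.exitRate (q, p') = M.exitRate (q, p) := by
    unfold exitRate
    rw [← e.tsum_eq]
    exact tsum_congr hr
  have he : e (q, p) = (q, p') := by
    refine Prod.ext rfl (Subtype.ext ?_)
    show (translate p p' p).1 = p'.1
    rw [translate_val]; ring
  have hj : M.jumpChain (q, p') = (M.jumpChain (q, p)).map e := by
    by_cases h : M.exitRate (q, p) ≠ 0 ∧ M.exitRate (q, p) ≠ ∞
    · have h' : M.exitRate (q, p') ≠ 0 ∧ M.exitRate (q, p') ≠ ∞ := by rwa [hx]
      unfold jumpChain
      rw [dif_pos h, dif_pos h']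
      ext y
      obtain ⟨z, rfl⟩ := e.surjective y
      rw [PMF.map_apply, tsum_eq_single z]
      · rw [if_pos rfl, PMF.normalize_apply, PMF.normalize_apply, hr]
        congr 2
      · intro b hb
        rw [if_neg (fun hh => hb (e.injective hh).symm)]
    · have h' : ¬ (M.exitRate (q, p') ≠ 0 ∧ M.exitRate (q, p') ≠ ∞) := by rwa [hx]
      unfold jumpChain
      rw [dif_neg h, dif_neg h', PMF.pure_map, he]
  unfold eventLaw
  rw [hj, PMF.map_comp]
  congr 1
  funext y
  refine Prod.ext rfl ?_
  have hd : (translate p p' y.2).1 - p'.1 = y.2.1 - p.1 := by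
    rw [translate_val]; ring
  show increment p' (translate p p' y.2) = increment p y.2
  unfold increment
  rw [hd]

/-! ### Derived quantities -/

/-- `f_i^*(q)` -/
def fStar (i : Fin (2 * K)) (q : Book K) : ℝ≥0 := ∑' n, M.f i q n

/-- `g_i^*(q)` -/
def gStar (i : Fin (2 * K)) (q : Book K) : ℝ≥0 := ∑' n, M.g i q n

/-- `∑_i (f_i^*(q) + g_i^*(q))` -/
def flow (q : Book K) : ℝ≥0 := ∑ i, (M.fStar i q + M.gStar i q)

/-- `a_i^*(q)` -/
def aStar (i : Fin (2 * K)) (q : Book K) : ℝ≥0 := M.fStar i q / M.flow q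

/-- `b_i^*(q)` -/
def bStar (i : Fin (2 * K)) (q : Book K) : ℝ≥0 := M.gStar i q / M.flow q

/-- `G^{f,i,q}(z)`, with the convention `0 / 0 = 0` -/
def Gf (i : Fin (2 * K)) (q : Book K) (z : ℝ≥0) : ℝ≥0∞ :=
  ∑' n : ℕ+, ((z ^ (n : ℕ) * (M.f i q n / M.fStar i q) : ℝ≥0) : ℝ≥0∞)

/-- `G^{g,i,q}(z)`, with the convention `0 / 0 = 0` -/
def Gg (i : Fin (2 * K)) (q : Book K) (z : ℝ≥0) : ℝ≥0∞ :=
  ∑' n : ℕ+, ((z ^ (n : ℕ) * (M.g i q n / M.gStar i q) : ℝ≥0) : ℝ≥0∞)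

/-- `z^{|m| - U}` -/
def zpow (U : ℝ) (z : ℝ≥0) (m : ℤ) : ℝ≥0 := z ^ (|(m : ℝ)| - U)

/-- `V^z(q) = ∑_i z^{|q_i| - U}` -/
def Vz (U : ℝ) (z : ℝ≥0) (q : Book K) : ℝ≥0 := ∑ i, zpow U z (q.1 i)

/-- The norm of `(q, c)` as a vector. -/
def ynorm (y : M.YState) : ℝ := ‖((y.1.1, y.2.1) : (Fin (2 * K) → ℤ) × ℝ)‖

/-! ### Assumptions -/

/-- The standing conventions on the parameters: positive tick, `θ` a probability, finite total
rates, no rate towards a vector outside `Ω`, no state without order flow, and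
total rates `u(q)`, `d(q)` for the price jumps (in particular a shifted book lies in `Ω`). -/
structure Standing : Prop where
  α_pos : 0 < M.α
  θ_le_one : M.θ ≤ 1
  f_summable : ∀ i q, Summable (M.f i q)
  g_summable : ∀ i q, Summable (M.g i q)
  f_unused : ∀ i (q : Book K) (n : ℕ+),
    (¬ ∃ q' : Book K, q'.1 = q.1 + Pi.single i ((n : ℕ) : ℤ)) → M.f i q n = 0
  g_unused : ∀ i (q : Book K) (n : ℕ+),
    (¬ ∃ q' : Book K, q'.1 = q.1 - Pi.single i ((n : ℕ) : ℤ)) → M.g i q n = 0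
  flow_pos : ∀ q, 0 < M.flow q
  up_total : ∀ q, ∑' q', M.upRate q q' = M.u q
  down_total : ∀ q, ∑' q', M.downRate q q' = M.d q

/-- `X` is irreducible and its embedded chain is aperiodic. -/
def IrreducibleAperiodic : Prop :=
  ChainIrreducible M.jumpChain ∧ ChainAperiodic M.jumpChain

/-- No queue changes sign in one order book jump. -/
def NoSignReversal : Prop :=
  ∀ (q : Book K) (i : Fin (2 * K)) (n : ℕ+),
    (bestAsk q.1 ≤ i → q.1 i < (n : ℕ) → M.g i q n = 0) ∧
    ((i : WithBot (Fin (2 * K))) ≤ bestBid q.1 → -q.1 i < (n : ℕ) → M.f i q n = 0)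

/-- Finite exponential moments of the order sizes. -/
def ExpMoments : Prop :=
  ∃ zs : ℝ≥0, 1 < zs ∧ ∀ i q, M.Gf i q zs < ∞ ∧ M.Gg i q zs < ∞

open Classical in
/-- For rates or proportions `a`, `b` of increases and decreases:
`limsup_{z → 1+} sup_q [a_i G^{f,i,q}(z) 1_{i > bestbid} + b_i G^{g,i,q}(z) 1_{i < bestask}] < L`
for some `L > 0` and all `i`. -/
def InsertionBound (a b : Fin (2 * K) → Book K → ℝ≥0) : Prop :=
  ∃ L : ℝ≥0, 0 < L ∧ ∀ i : Fin (2 * K),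
    limsup (fun z : ℝ≥0 => ⨆ q : Book K,
      ((if bestBid q.1 < (i : WithBot (Fin (2 * K))) then (a i q : ℝ≥0∞) * M.Gf i q z else 0) +
       (if (i : WithTop (Fin (2 * K))) < bestAsk q.1 then (b i q : ℝ≥0∞) * M.Gg i q z else 0)))
      (𝓝[>] 1) < (L : ℝ≥0∞)

/-- Positivity of `B_f(z)` and `B_g(z)` for all `z > 1`. -/
def SizeBound (U : ℝ) : Prop :=
  ∀ z : ℝ≥0, 1 < z →
    (0 : EReal) < (⨅ (q : Book K) (i : Fin (2 * K)) (_ : U < q.1 i) (_ : bestAsk q.1 ≤ i),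
      ((M.Gf i q z : EReal) - 1)) ∧
    (0 : EReal) < (⨅ (q : Book K) (i : Fin (2 * K)) (_ : (q.1 i : ℝ) < -U)
      (_ : (i : WithBot (Fin (2 * K))) ≤ bestBid q.1), ((M.Gg i q z : EReal) - 1))

/-- Negative drift of the large queues, in proportions. -/
def NegativeDrift (r U : ℝ) : Prop :=
  limsup (fun z : ℝ≥0 =>
      ⨆ (q : Book K) (i : Fin (2 * K)) (_ : U < q.1 i) (_ : bestAsk q.1 ≤ i),
      (((M.aStar i q : ℝ) - M.bStar i q *
        ((1 - (M.Gg i q z⁻¹).toReal) / ((M.Gf i q z).toReal - 1)) : ℝ) : EReal))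
    (𝓝[>] 1) < ((-r : ℝ) : EReal) ∧
  limsup (fun z : ℝ≥0 =>
      ⨆ (q : Book K) (i : Fin (2 * K)) (_ : (q.1 i : ℝ) < -U)
        (_ : (i : WithBot (Fin (2 * K))) ≤ bestBid q.1),
      (((M.bStar i q : ℝ) - M.aStar i q *
        ((1 - (M.Gf i q z⁻¹).toReal) / ((M.Gg i q z).toReal - 1)) : ℝ) : EReal))
    (𝓝[>] 1) < ((-r : ℝ) : EReal)

/-- Exponential moments of the reinitialization and boundary laws. -/
def BoundaryMoments (U : ℝ) : Prop :=
  ∃ z Lπ : ℝ≥0, 1 < z ∧ 0 < Lπ ∧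
    (∑' q, M.πinc q * (Vz U z q : ℝ≥0∞)) + (∑' q, M.πdec q * (Vz U z q : ℝ≥0∞)) +
    (∑' l, M.πK l * (zpow U z l : ℝ≥0∞)) + (∑' l, M.πmK l * (zpow U z l : ℝ≥0∞)) ≤ (Lπ : ℝ≥0∞)

/-- Outside a finite set, the proportion of price jumps is bounded away from one. -/
def PriceJumpBound : Prop :=
  ∃ W : Set (Book K), W.Finite ∧
    (⨆ q : {q : Book K // q ∉ W},
      (((M.u q + M.d q) / (M.flow q + M.u q + M.d q) : ℝ≥0) : ℝ≥0∞)) < 1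

end OrderBook

end

/-!
The chain `Ychain` depends on its state only through the shape `q`, and the weight
`V q = ∑ i, z ^ (|q i| - U)`, for `z > 1` close to `1`, decreases geometrically along it.

* Under the pure order book jumps, a queue with `|q i| > U` changes its weight at a rate at most
  `-r (G(z) - 1)` times its weight and the total flow, where `G` generates the insertion sizes of
  that queue. The drift assumption is exactly this inequality, and `G(z) - 1` is bounded below by
  some `δ > 0`. A queue with `|q i| ≤ U` has weight at most one, and only its insertions can raise
  it, at a rate bounded by the flow. This is `OrderBook.queue_drift`, summed in
  `OrderBook.pure_drift`.
* A price jump either shifts the book, which adds at most the weight of the entering queue, or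
  redraws it; in both cases it adds a bounded mean weight (`OrderBook.shift_drift`). Outside
  a finite set of shapes the order flow carries a fixed proportion of the total jump rate, so the
  decrease survives the normalization that leads to the chain
  (`OrderBook.exists_geometric_drift`).

The sublevel sets of `V` are finite, and irreducibility and aperiodicity make some state `x₀`
reachable at all large times from everywhere. What remains is a theorem on countable chains,
`geometric_ergodicity_of_drift`, proved along the lines of Hairer and Mattingly. Run two
independent copies of a power of the chain and merge them when they meet at `x₀`. For the weight
`1 + β V` with `β` small, the pair contracts: far out by the drift, and on a sublevel set because
the merging probability is bounded below there (`exists_merged_contraction`). Hence the laws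
started at two states approach each other exponentially fast in the weighted total variation
distance; the iterates from one state form a Cauchy sequence, whose limit is the invariant law.

For Harris recurrence, let `g y` be the probability of never being at an atom `x₀` of the invariant
law `π`, starting from `y`. Then `g ≤ P g`, so `g` is at most its mean under `π`, and `g x₀ = 0`
forces this mean to vanish (`subharmonic_eq_zero`).
-/

/-! ### Weighted total variation -/

section WeightedDistance

variable {S T T' : Type*}

/-- The `w`-weighted total variation distance `∑ y, w y * |μ y - ν y|`, written with truncated
subtractions so that it makes sense in `ℝ≥0∞` without summability side conditions. The arguments
are mass functions rather than `PMF`s: limits of laws are compared before they are known to have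
total mass one. -/
noncomputable def wDist (w μ ν : S → ℝ≥0∞) : ℝ≥0∞ :=
  ∑' y, w y * ((μ y - ν y) + (ν y - μ y))

theorem wDist_self (w μ : S → ℝ≥0∞) : wDist w μ μ = 0 := by
  simp [wDist]

theorem wDist_comm (w μ ν : S → ℝ≥0∞) : wDist w μ ν = wDist w ν μ := by
  simp only [wDist, add_comm]

theorem wDist_triangle (w μ ν κ : S → ℝ≥0∞) :
    wDist w μ κ ≤ wDist w μ ν + wDist w ν κ := by
  unfold wDist
  rw [← ENNReal.tsum_add]
  refine ENNReal.tsum_le_tsum fun y => ?_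
  rw [← mul_add]
  refine mul_le_mul_right ?_ (w y)
  calc (μ y - κ y) + (κ y - μ y)
      ≤ ((μ y - ν y) + (ν y - κ y)) + ((κ y - ν y) + (ν y - μ y)) :=
        add_le_add tsub_le_tsub_add_tsub tsub_le_tsub_add_tsub
    _ = _ := by ring

theorem wDist_le_add (w μ ν : S → ℝ≥0∞) :
    wDist w μ ν ≤ (∑' y, μ y * w y) + ∑' y, ν y * w y := by
  unfold wDist
  rw [← ENNReal.tsum_add]
  refine ENNReal.tsum_le_tsum fun y => ?_
  rw [mul_comm (μ y), mul_comm (ν y), ← mul_add]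
  gcongr <;> exact tsub_le_self

theorem wDist_mono {w w' : S → ℝ≥0∞} (h : ∀ y, w y ≤ w' y) (μ ν : S → ℝ≥0∞) :
    wDist w μ ν ≤ wDist w' μ ν :=
  ENNReal.tsum_le_tsum fun y => mul_le_mul_left (h y) _

theorem wDist_const_mul (c : ℝ≥0∞) (w μ ν : S → ℝ≥0∞) :
    wDist (fun y => c * w y) μ ν = c * wDist w μ ν := by
  unfold wDist
  rw [← ENNReal.tsum_mul_left]
  exact tsum_congr fun y => mul_assoc _ _ _

theorem tsum_mul_le_add_wDist {w h : S → ℝ≥0∞} (hw : ∀ y, h y ≤ w y) (μ ν : S → ℝ≥0∞) :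
    ∑' y, μ y * h y ≤ (∑' y, ν y * h y) + wDist w μ ν := by
  unfold wDist
  rw [← ENNReal.tsum_add]
  refine ENNReal.tsum_le_tsum fun y => ?_
  calc μ y * h y ≤ (ν y + (μ y - ν y)) * h y := by gcongr; exact le_add_tsub
    _ = ν y * h y + h y * (μ y - ν y) := by ring
    _ ≤ ν y * h y + w y * ((μ y - ν y) + (ν y - μ y)) := by
      gcongr
      exacts [hw y, le_self_add]

/-- Lower semicontinuity of the distance under pointwise convergence. -/
theorem wDist_le_of_tendsto {w μ ν : S → ℝ≥0∞} {a : ℕ → S → ℝ≥0∞} {B : ℝ≥0∞}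
    (hw : ∀ y, w y ≠ ∞) (hμ : ∀ y, μ y ≠ ∞) (hν : ∀ y, ν y ≠ ∞)
    (ha : ∀ y, Tendsto (fun n => a n y) atTop (𝓝 (ν y)))
    (hB : ∀ᶠ n in atTop, wDist w μ (a n) ≤ B) : wDist w μ ν ≤ B := by
  unfold wDist
  rw [ENNReal.tsum_eq_iSup_sum]
  refine iSup_le fun F => ?_
  have hlim : Tendsto (fun n => ∑ y ∈ F, w y * ((μ y - a n y) + (a n y - μ y))) atTop
      (𝓝 (∑ y ∈ F, w y * ((μ y - ν y) + (ν y - μ y)))) := by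
    refine tendsto_finsetSum _ fun y _ => ENNReal.Tendsto.const_mul ?_ (Or.inr (hw y))
    exact (ENNReal.Tendsto.sub tendsto_const_nhds (ha y) (Or.inl (hμ y))).add
      (ENNReal.Tendsto.sub (ha y) tendsto_const_nhds (Or.inl (hν y)))
  refine le_of_tendsto hlim (hB.mono fun n hn => le_trans ?_ hn)
  exact ENNReal.sum_le_tsum F

theorem tsum_mul_tsub_tsum_mul_le (μ : PMF T) (ν : PMF T') (A : T → ℝ≥0∞) (B : T' → ℝ≥0∞) :
    (∑' u, μ u * A u) - (∑' v, ν v * B v) ≤ ∑' u, ∑' v, μ u * ν v * (A u - B v) := by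
  rw [tsub_le_iff_right]
  have h1 : ∑' u, μ u * A u = ∑' u, ∑' v, μ u * ν v * A u := by
    refine tsum_congr fun u => ?_
    rw [ENNReal.tsum_mul_right, ENNReal.tsum_mul_left, ν.tsum_coe, mul_one]
  have h2 : ∑' v, ν v * B v = ∑' u, ∑' v, μ u * ν v * B v := by
    simp_rw [mul_assoc, ENNReal.tsum_mul_left]
    rw [ENNReal.tsum_mul_right, μ.tsum_coe, one_mul]
  rw [h1, h2, ← ENNReal.tsum_add]
  refine ENNReal.tsum_le_tsum fun u => ?_
  rw [← ENNReal.tsum_add]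
  refine ENNReal.tsum_le_tsum fun v => ?_
  rw [← mul_add]
  gcongr
  exact le_tsub_add

/-- Convexity of the distance, in the form given by the independent coupling of `μ` and `ν`. -/
theorem wDist_bind_bind_le (w : S → ℝ≥0∞) (μ : PMF T) (ν : PMF T') (κ : T → PMF S)
    (η : T' → PMF S) :
    wDist w (μ.bind κ) (ν.bind η) ≤ ∑' u, ∑' v, μ u * ν v * wDist w (κ u) (η v) := by
  have step : wDist w (μ.bind κ) (ν.bind η) ≤
      ∑' y, ∑' u, ∑' v, μ u * ν v * (w y * ((κ u y - η v y) + (η v y - κ u y))) := by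
    refine ENNReal.tsum_le_tsum fun y => ?_
    rw [PMF.bind_apply, PMF.bind_apply]
    have h1 := tsum_mul_tsub_tsum_mul_le μ ν (fun u => κ u y) (fun v => η v y)
    have h2 := tsum_mul_tsub_tsum_mul_le ν μ (fun v => η v y) (fun u => κ u y)
    rw [ENNReal.tsum_comm] at h2
    refine (mul_le_mul_right (add_le_add h1 h2) (w y)).trans (le_of_eq ?_)
    rw [← ENNReal.tsum_add, ← ENNReal.tsum_mul_left]
    refine tsum_congr fun u => ?_
    rw [← ENNReal.tsum_add, ← ENNReal.tsum_mul_left]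
    refine tsum_congr fun v => ?_
    ring
  refine step.trans (le_of_eq ?_)
  rw [ENNReal.tsum_comm]
  refine tsum_congr fun u => ?_
  rw [ENNReal.tsum_comm]
  refine tsum_congr fun v => ?_
  rw [ENNReal.tsum_mul_left]
  rfl

theorem tsum_pure_mul (x : S) (h : S → ℝ≥0∞) : ∑' y, PMF.pure x y * h y = h x := by
  classical
  rw [tsum_eq_single x]
  · simp
  · intro y hy
    simp [hy]

theorem tsum_bind_mul (μ : PMF T) (κ : T → PMF S) (h : S → ℝ≥0∞) :
    ∑' y, μ.bind κ y * h y = ∑' u, μ u * ∑' y, κ u y * h y := by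
  simp_rw [PMF.bind_apply, ← ENNReal.tsum_mul_right, ← ENNReal.tsum_mul_left]
  rw [ENNReal.tsum_comm]
  simp_rw [mul_assoc]

theorem wDist_bind_le (w : S → ℝ≥0∞) (μ : PMF S) (ν : PMF T) (η : T → PMF S) :
    wDist w μ (ν.bind η) ≤ ∑' v, ν v * wDist w μ (η v) := by
  have h := wDist_bind_bind_le w (PMF.pure ()) ν (fun _ => μ) η
  rw [PMF.pure_bind] at h
  simpa using h

theorem wDist_eq_vDist {V : S → ℝ≥0} (μ ν : PMF S) :
    vDist (fun y => (V y : ℝ)) μ ν = wDist (fun y => (V y : ℝ≥0∞)) μ ν := by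
  refine tsum_congr fun y => ?_
  rw [ENNReal.ofReal_mul (NNReal.coe_nonneg _), ENNReal.ofReal_coe_nnreal]
  congr 1
  have h1 := μ.apply_ne_top y
  have h2 := ν.apply_ne_top y
  rcases le_total (μ y) (ν y) with h | h
  · rw [tsub_eq_zero_of_le h, zero_add, abs_sub_comm,
      abs_of_nonneg (sub_nonneg.2 (ENNReal.toReal_mono h2 h)),
      ← ENNReal.toReal_sub_of_le h h2, ENNReal.ofReal_toReal (ENNReal.sub_ne_top h2)]
  · rw [tsub_eq_zero_of_le h, add_zero,
      abs_of_nonneg (sub_nonneg.2 (ENNReal.toReal_mono h1 h)),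
      ← ENNReal.toReal_sub_of_le h h1, ENNReal.ofReal_toReal (ENNReal.sub_ne_top h1)]

end WeightedDistance

/-! ### Iterates of a transition function -/

section Iterates

variable {S : Type*}

theorem stepLaw_add (P : S → PMF S) (m n : ℕ) (x : S) :
    stepLaw P (m + n) x = (stepLaw P m x).bind (stepLaw P n) := by
  induction m generalizing x with
  | zero => simp [stepLaw]
  | succ m ih =>
    rw [Nat.succ_add]
    simp only [stepLaw, PMF.bind_bind]
    congr 1
    funext y
    exact ih y

theorem stepLaw_mul (P : S → PMF S) (m k : ℕ) (x : S) :
    stepLaw P (m * k) x = stepLaw (stepLaw P m) k x := by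
  induction k generalizing x with
  | zero => rfl
  | succ k ih =>
    rw [Nat.mul_succ, add_comm, stepLaw_add]
    simp only [stepLaw]
    congr 1
    funext y
    exact ih y

theorem stepLaw_add_ne_zero {P : S → PMF S} {m n : ℕ} {x y z : S}
    (hxy : stepLaw P m x y ≠ 0) (hyz : stepLaw P n y z ≠ 0) : stepLaw P (m + n) x z ≠ 0 := by
  rw [stepLaw_add, PMF.bind_apply]
  intro h
  exact mul_ne_zero hxy hyz (ENNReal.tsum_eq_zero.1 h y)

/-- A drift inequality survives iteration, with an additive constant `c` that does not depend on
the number of steps; the smallest choice is `c = b / (1 - lam)`. -/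
theorem drift_stepLaw {P : S → PMF S} {V : S → ℝ≥0∞} {lam b c : ℝ≥0∞} (hc : lam * c + b ≤ c)
    (drift : ∀ x, ∑' y, P x y * V y ≤ lam * V x + b) (n : ℕ) (x : S) :
    ∑' y, stepLaw P n x y * V y ≤ lam ^ n * V x + c := by
  induction n with
  | zero => simp [stepLaw]
  | succ n ih =>
    rw [stepLaw_add, tsum_bind_mul]
    calc ∑' u, stepLaw P n x u * ∑' y, stepLaw P 1 u y * V y
        ≤ ∑' u, stepLaw P n x u * (lam * V u + b) := by
          refine ENNReal.tsum_le_tsum fun u => mul_le_mul_right ?_ _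
          have h : stepLaw P 1 u = P u := by
            show (P u).bind PMF.pure = P u
            exact PMF.bind_pure _
          rw [h]
          exact drift u
      _ = lam * (∑' u, stepLaw P n x u * V u) + b := by
          simp_rw [mul_add]
          rw [ENNReal.tsum_add, ENNReal.tsum_mul_right, PMF.tsum_coe, one_mul,
            ← ENNReal.tsum_mul_left]
          congr 1
          exact tsum_congr fun u => mul_left_comm _ _ _
      _ ≤ lam * (lam ^ n * V x + c) + b := by gcongr
      _ = lam ^ (n + 1) * V x + (lam * c + b) := by ring
      _ ≤ lam ^ (n + 1) * V x + c := by gcongr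

end Iterates

/-! ### Contraction of the weighted distance -/

section Contraction

variable {S : Type*}

open Classical in
/-- If two independent copies, weighted by `w u + w v` but merged when they meet at `x₀`, contract
by the factor `ρ`, then so do the laws of the chain. -/
theorem wDist_stepLaw_le {Q : S → PMF S} {w : S → ℝ≥0∞} {x₀ : S} {ρ : ℝ≥0∞}
    (h : ∀ x y, ∑' u, ∑' v, Q x u * Q y v * (if u = x₀ ∧ v = x₀ then 0 else w u + w v)
      ≤ ρ * (w x + w y)) (k : ℕ) (x y : S) :
    wDist w (stepLaw Q k x) (stepLaw Q k y) ≤ ρ ^ k * (w x + w y) := by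
  induction k generalizing x y with
  | zero => simpa [stepLaw, tsum_pure_mul] using wDist_le_add w (PMF.pure x) (PMF.pure y)
  | succ k ih =>
    simp only [stepLaw]
    refine (wDist_bind_bind_le w _ _ _ _).trans ?_
    calc ∑' u, ∑' v, Q x u * Q y v * wDist w (stepLaw Q k u) (stepLaw Q k v)
        ≤ ∑' u, ∑' v, ρ ^ k *
            (Q x u * Q y v * (if u = x₀ ∧ v = x₀ then 0 else w u + w v)) := by
          refine ENNReal.tsum_le_tsum fun u => ENNReal.tsum_le_tsum fun v => ?_
          rw [mul_left_comm]
          refine mul_le_mul_right ?_ _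
          split_ifs with huv
          · rw [huv.1, huv.2, wDist_self, mul_zero]
          · exact ih u v
      _ ≤ ρ ^ k * (ρ * (w x + w y)) := by
          simp_rw [ENNReal.tsum_mul_left]
          exact mul_le_mul_right (h x y) _
      _ = ρ ^ (k + 1) * (w x + w y) := by ring

theorem tsum_tsum_mul_mul_add (μ ν : PMF S) (w : S → ℝ≥0∞) :
    ∑' u, ∑' v, μ u * ν v * (w u + w v) = (∑' u, μ u * w u) + ∑' v, ν v * w v := by
  simp_rw [mul_add, ENNReal.tsum_add]
  congr 1
  · refine tsum_congr fun u => ?_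
    rw [ENNReal.tsum_mul_right, ENNReal.tsum_mul_left, PMF.tsum_coe, mul_one]
  · simp_rw [mul_assoc, ENNReal.tsum_mul_left]
    rw [ENNReal.tsum_mul_right, PMF.tsum_coe, one_mul]

open Classical in
/-- Merging at `x₀` saves at least twice the probability that both copies sit there. -/
theorem tsum_merged_add_le (Q : S → PMF S) {w : S → ℝ≥0∞} (hw : ∀ x, 1 ≤ w x) (x₀ x y : S) :
    (∑' u, ∑' v, Q x u * Q y v * (if u = x₀ ∧ v = x₀ then 0 else w u + w v))
      + 2 * (Q x x₀ * Q y x₀) ≤ (∑' u, Q x u * w u) + ∑' v, Q y v * w v := by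
  have h2 : 2 * (Q x x₀ * Q y x₀)
      = ∑' u, ∑' v, (if u = x₀ ∧ v = x₀ then 2 * (Q x x₀ * Q y x₀) else 0) := by
    rw [tsum_eq_single x₀ (fun u hu => by simp [hu]), tsum_eq_single x₀ (fun v hv => by simp [hv])]
    simp
  rw [← tsum_tsum_mul_mul_add, h2, ← ENNReal.tsum_add]
  refine ENNReal.tsum_le_tsum fun u => ?_
  rw [← ENNReal.tsum_add]
  refine ENNReal.tsum_le_tsum fun v => ?_
  split_ifs with huv
  · rw [huv.1, huv.2, mul_zero, zero_add, mul_comm]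
    gcongr
    calc (2 : ℝ≥0∞) = 1 + 1 := by norm_num
      _ ≤ _ := add_le_add (hw _) (hw _)
  · simp

theorem exists_drift_const {lam : ℝ≥0} (b : ℝ≥0) (hlam : lam < 1) :
    ∃ c : ℝ≥0, lam * c + b = c := by
  have hlam' : (lam : ℝ) < 1 := by exact_mod_cast hlam
  have h1lam : 0 < 1 - (lam : ℝ) := by linarith
  obtain ⟨c, hc0, hc⟩ : ∃ c : ℝ, 0 ≤ c ∧ lam * c + b = c :=
    ⟨b / (1 - lam), by positivity, by field_simp; ring⟩
  lift c to ℝ≥0 using hc0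
  exact ⟨c, by exact_mod_cast hc⟩

/-- The constants in the contraction: `β` is small enough for the merging probability `ε` to
absorb the additive drift constant, and `R` large enough for the drift to contract beyond it. -/
theorem exists_contraction_constants {lam c R ε : ℝ} (hlam0 : 0 ≤ lam) (hlam : lam < 1)
    (hc : 0 ≤ c) (hR : 0 < R) (hRc : 4 * c ≤ (1 - lam) * R) (hε : 0 < ε) :
    ∃ β ρ : ℝ, 0 < β ∧ 0 < ρ ∧ ρ < 1 ∧
      (∀ s, R ≤ s → 2 + β * (lam * s + 2 * c) ≤ ρ * (2 + β * s)) ∧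
      (∀ s, 0 ≤ s → 2 + β * (lam * s + 2 * c) - 2 * ε ≤ ρ * (2 + β * s)) := by
  set β := ε / (2 * c + 1) with hβ
  have hβ0 : 0 < β := by positivity
  have hβc : β * (2 * c) ≤ ε := by
    have : β * (2 * c + 1) = ε := by rw [hβ]; field_simp
    nlinarith
  set t := min (min ((1 - lam) / 4) (ε / 2)) (β * (1 - lam) * R / 8) with ht
  have ht1 : t ≤ (1 - lam) / 4 := (min_le_left _ _).trans (min_le_left _ _)
  have ht2 : t ≤ ε / 2 := (min_le_left _ _).trans (min_le_right _ _)
  have ht3 : t ≤ β * (1 - lam) * R / 8 := min_le_right _ _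
  have h1 : 0 < 1 - lam := by linarith
  have ht0 : 0 < t := lt_min (lt_min (by linarith) (by linarith)) (by positivity)
  refine ⟨β, 1 - t, hβ0, by linarith, by linarith, fun s hs => ?_, fun s hs => ?_⟩
  · have hb : 0 ≤ β * (1 - lam) := by positivity
    have a1 : β * (1 - lam) * R ≤ β * (1 - lam) * s := mul_le_mul_of_nonneg_left hs hb
    have a2 : β * (4 * c) ≤ β * ((1 - lam) * R) := mul_le_mul_of_nonneg_left hRc hβ0.le
    have a3 : t * (β * s) ≤ (1 - lam) / 4 * (β * s) :=
      mul_le_mul_of_nonneg_right ht1 (mul_nonneg hβ0.le (hR.le.trans hs))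
    nlinarith
  · have a3 : t * (β * s) ≤ (1 - lam) / 4 * (β * s) :=
      mul_le_mul_of_nonneg_right ht1 (mul_nonneg hβ0.le hs)
    have a4 : 0 ≤ (1 - lam) * (β * s) := mul_nonneg h1.le (mul_nonneg hβ0.le hs)
    nlinarith

open Classical in
/-- A drift towards finite sublevel sets, all of which reach `x₀` at a common time, makes some
power of the chain a contraction for the weight `1 + β V`. -/
theorem exists_merged_contraction {P : S → PMF S} {V : S → ℝ≥0} {lam b : ℝ≥0} (hlam : lam < 1)
    (drift : ∀ x, ∑' y, P x y * (V y : ℝ≥0∞) ≤ lam * V x + b)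
    (hfin : ∀ c : ℝ≥0, {x | V x ≤ c}.Finite) {x₀ : S}
    (hreach : ∀ x, ∃ N, ∀ n ≥ N, stepLaw P n x x₀ ≠ 0) :
    ∃ (m : ℕ) (β ρ : ℝ≥0), 0 < m ∧ 0 < β ∧ 0 < ρ ∧ ρ < 1 ∧ ∀ x y,
      ∑' u, ∑' v, stepLaw P m x u * stepLaw P m y v *
        (if u = x₀ ∧ v = x₀ then 0
          else ((1 + β * V u : ℝ≥0) : ℝ≥0∞) + ((1 + β * V v : ℝ≥0) : ℝ≥0∞))
      ≤ ρ * (((1 + β * V x : ℝ≥0) : ℝ≥0∞) + ((1 + β * V y : ℝ≥0) : ℝ≥0∞)) := by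
  have hlam' : (lam : ℝ) < 1 := by exact_mod_cast hlam
  have h1lam : 0 < 1 - (lam : ℝ) := by linarith
  obtain ⟨c, hc⟩ := exists_drift_const b hlam
  set R : ℝ≥0 := ⟨4 * c / (1 - lam) + 1, by positivity⟩ with hRdef
  have hRv : (R : ℝ) = 4 * c / (1 - lam) + 1 := rfl
  have hR0 : (0 : ℝ) < R := by rw [hRv]; positivity
  have hRc : 4 * (c : ℝ) ≤ (1 - lam) * R := by
    rw [hRv, mul_add, mul_div_cancel₀ _ h1lam.ne']
    linarith
  choose N hN using hreach
  set m := (hfin R).toFinset.sup N + 1 with hm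
  have hmpos : 0 < m := Nat.succ_pos _
  have hpos : ∀ x, V x ≤ R → stepLaw P m x x₀ ≠ 0 := fun x hx =>
    hN x m ((Finset.le_sup (f := N) ((hfin R).mem_toFinset.2 hx)).trans (Nat.le_succ _))
  obtain ⟨ε, hε0, hε⟩ : ∃ ε : ℝ≥0, 0 < ε ∧ ∀ x, V x ≤ R → (ε : ℝ≥0∞) ≤ stepLaw P m x x₀ := by
    have h : ∃ e : ℝ≥0∞, 0 < e ∧ e ≠ ∞ ∧ ∀ x, V x ≤ R → e ≤ stepLaw P m x x₀ := by
      refine ⟨min 1 ((hfin R).toFinset.inf fun x => stepLaw P m x x₀), ?_, ?_, fun x hx => ?_⟩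
      · refine lt_min one_pos ((Finset.lt_inf_iff ENNReal.coe_lt_top).2 fun x hx => ?_)
        exact pos_iff_ne_zero.2 (hpos x ((hfin R).mem_toFinset.1 hx))
      · exact ne_top_of_le_ne_top ENNReal.one_ne_top (min_le_left _ _)
      · exact (min_le_right _ _).trans (Finset.inf_le ((hfin R).mem_toFinset.2 hx))
    obtain ⟨e, h0, h1, h2⟩ := h
    lift e to ℝ≥0 using h1
    exact ⟨e, by exact_mod_cast h0, h2⟩
  have hdrift : ∀ x, ∑' y, stepLaw P m x y * (V y : ℝ≥0∞) ≤ lam * V x + c := fun x => by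
    refine (drift_stepLaw (c := (c : ℝ≥0∞)) (by exact_mod_cast hc.le) drift m x).trans ?_
    gcongr
    exact pow_le_of_le_one zero_le (by exact_mod_cast hlam.le) hmpos.ne'
  obtain ⟨β, ρ, hβ, hρ0, hρ1, far, near⟩ := exists_contraction_constants lam.coe_nonneg hlam' c.coe_nonneg hR0 hRc
    (ε := (ε : ℝ) * ε) (by positivity)
  lift β to ℝ≥0 using hβ.le
  lift ρ to ℝ≥0 using hρ0.le
  refine ⟨m, β, ρ, hmpos, by exact_mod_cast hβ, by exact_mod_cast hρ0, by exact_mod_cast hρ1,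
    fun x y => ?_⟩
  have hmean : ∀ x, ∑' u, stepLaw P m x u * ((1 + β * V u : ℝ≥0) : ℝ≥0∞)
      ≤ ((1 + β * (lam * V x + c) : ℝ≥0) : ℝ≥0∞) := fun x => by
    push_cast
    simp_rw [mul_add, mul_one]
    rw [ENNReal.tsum_add, PMF.tsum_coe]
    simp_rw [mul_left_comm _ (β : ℝ≥0∞)]
    rw [ENNReal.tsum_mul_left, ← mul_add]
    gcongr
    exact hdrift x
  have hmerge := (tsum_merged_add_le (stepLaw P m)
    (w := fun u => ((1 + β * V u : ℝ≥0) : ℝ≥0∞))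
    (fun u => by exact_mod_cast le_self_add) x₀ x y).trans (add_le_add (hmean x) (hmean y))
  generalize (∑' u, ∑' v, stepLaw P m x u * stepLaw P m y v *
        (if u = x₀ ∧ v = x₀ then 0
          else ((1 + β * V u : ℝ≥0) : ℝ≥0∞) + ((1 + β * V v : ℝ≥0) : ℝ≥0∞))) = A at hmerge ⊢
  have hA : A ≠ ∞ := by
    refine ne_top_of_le_ne_top ?_ (le_self_add.trans hmerge)
    rw [← ENNReal.coe_add]
    exact ENNReal.coe_ne_top
  lift A to ℝ≥0 using hA
  by_cases hs : (R : ℝ) ≤ V x + V y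
  · have h1 : (A : ℝ) ≤ (1 + β * (lam * V x + c)) + (1 + β * (lam * V y + c)) := by
      exact_mod_cast le_self_add.trans hmerge
    have h2 := far _ hs
    have : (A : ℝ) ≤ ρ * ((1 + β * V x) + (1 + β * V y)) := by linarith
    exact_mod_cast this
  · have hx : V x ≤ R := by
      have : (V x : ℝ) ≤ R := by push Not at hs; linarith [(V y).coe_nonneg]
      exact_mod_cast this
    have hy : V y ≤ R := by
      have : (V y : ℝ) ≤ R := by push Not at hs; linarith [(V x).coe_nonneg]
      exact_mod_cast this
    have h0 : (A : ℝ≥0∞) + 2 * (ε * ε) ≤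
        ((1 + β * (lam * V x + c) : ℝ≥0) : ℝ≥0∞) + ((1 + β * (lam * V y + c) : ℝ≥0) : ℝ≥0∞) := by
      refine le_trans ?_ hmerge
      gcongr
      exacts [hε x hx, hε y hy]
    have h1 : (A : ℝ) + 2 * (ε * ε) ≤
        (1 + β * (lam * V x + c)) + (1 + β * (lam * V y + c)) := by exact_mod_cast h0
    have h2 := near (V x + V y) (by positivity)
    have : (A : ℝ) ≤ ρ * ((1 + β * V x) + (1 + β * V y)) := by linarith
    exact_mod_cast this

end Contraction

/-! ### Geometric ergodicity -/

section Ergodicity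

variable {S : Type*}

/-- Exponential forgetting of the initial state, in the weight `V`. -/
theorem exists_wDist_stepLaw_le {P : S → PMF S} {V : S → ℝ≥0} (hV : ∀ x, 1 ≤ V x)
    {lam b : ℝ≥0} (hlam : lam < 1)
    (drift : ∀ x, ∑' y, P x y * (V y : ℝ≥0∞) ≤ lam * V x + b)
    (hfin : ∀ c : ℝ≥0, {x | V x ≤ c}.Finite) {x₀ : S}
    (hreach : ∀ x, ∃ N, ∀ n ≥ N, stepLaw P n x x₀ ≠ 0) :
    ∃ C r : ℝ≥0, 0 < r ∧ r < 1 ∧ ∀ (n : ℕ) x y,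
      wDist (fun y => (V y : ℝ≥0∞)) (stepLaw P n x) (stepLaw P n y)
        ≤ C * r ^ n * (V x + V y) := by
  obtain ⟨m, β, ρ, hm, hβ, hρ0, hρ1, hcontr⟩ :=
    exists_merged_contraction hlam drift hfin hreach
  obtain ⟨c, hc⟩ := exists_drift_const b hlam
  set w : S → ℝ≥0∞ := fun u => ((1 + β * V u : ℝ≥0) : ℝ≥0∞) with hw
  set D : ℝ≥0 := 1 + β + β * c with hD
  set r : ℝ≥0 := ρ ^ (1 / (m : ℝ)) with hr
  have hr0 : 0 < r := NNReal.rpow_pos hρ0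
  have hr1 : r < 1 := NNReal.rpow_lt_one hρ1 (by positivity)
  have hrm : r ^ m = ρ := by
    rw [hr, ← NNReal.rpow_natCast, ← NNReal.rpow_mul, one_div, inv_mul_cancel₀ (by positivity),
      NNReal.rpow_one]
  have hmean : ∀ j x, ∑' u, stepLaw P j x u * w u ≤ D * V x := fun j x => by
    have h1 : ∑' u, stepLaw P j x u * (V u : ℝ≥0∞) ≤ V x + c := by
      refine (drift_stepLaw (c := (c : ℝ≥0∞)) (by exact_mod_cast hc.le) drift j x).trans ?_
      gcongr
      exact mul_le_of_le_one_left zero_le (pow_le_one₀ zero_le (by exact_mod_cast hlam.le))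
    calc ∑' u, stepLaw P j x u * w u
        = 1 + β * ∑' u, stepLaw P j x u * (V u : ℝ≥0∞) := by
          simp only [hw]
          push_cast
          simp_rw [mul_add, mul_one]
          rw [ENNReal.tsum_add, PMF.tsum_coe]
          simp_rw [mul_left_comm _ (β : ℝ≥0∞)]
          rw [ENNReal.tsum_mul_left]
      _ ≤ 1 + β * (V x + c) := by gcongr
      _ ≤ D * V x := by
          have : 1 + β * (V x + c) ≤ D * V x := by
            have h := hV x
            calc 1 + β * (V x + c) = 1 * 1 + β * V x + β * c * 1 := by ring
              _ ≤ 1 * V x + β * V x + β * c * V x := by gcongr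
              _ = D * V x := by rw [hD]; ring
          exact_mod_cast this
  refine ⟨β⁻¹ * ρ⁻¹ * D, r, hr0, hr1, fun n x y => ?_⟩
  obtain ⟨k, j, hj, hn⟩ : ∃ k j, j < m ∧ n = j + m * k :=
    ⟨n / m, n % m, Nat.mod_lt _ hm, (Nat.mod_add_div n m).symm⟩
  have hw_dist : wDist w (stepLaw P n x) (stepLaw P n y) ≤ ρ ^ k * (D * V x + D * V y) := by
    subst hn
    rw [stepLaw_add, stepLaw_add]
    refine (wDist_bind_bind_le w _ _ _ _).trans ?_
    calc ∑' u, ∑' v, stepLaw P j x u * stepLaw P j y v *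
          wDist w (stepLaw P (m * k) u) (stepLaw P (m * k) v)
        ≤ ∑' u, ∑' v, stepLaw P j x u * stepLaw P j y v * (ρ ^ k * (w u + w v)) := by
          refine ENNReal.tsum_le_tsum fun u => ENNReal.tsum_le_tsum fun v => ?_
          rw [stepLaw_mul, stepLaw_mul]
          exact mul_le_mul_right (wDist_stepLaw_le hcontr k u v) _
      _ = ρ ^ k * ((∑' u, stepLaw P j x u * w u) + ∑' v, stepLaw P j y v * w v) := by
          rw [← tsum_tsum_mul_mul_add]
          simp_rw [mul_left_comm _ ((ρ : ℝ≥0∞) ^ k), ENNReal.tsum_mul_left]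
      _ ≤ _ := by gcongr <;> apply hmean
  have hk : ρ ^ k ≤ ρ⁻¹ * r ^ n := by
    rw [le_inv_mul_iff₀ hρ0, hn, pow_add, pow_mul, hrm, ← hrm]
    refine mul_le_mul_left (pow_le_pow_of_le_one zero_le hr1.le hj.le) _
  have hVw : ∀ u, (V u : ℝ≥0∞) ≤ (β⁻¹ : ℝ≥0) * w u := fun u => by
    simp only [hw]
    have : V u ≤ β⁻¹ * (1 + β * V u) := by
      rw [mul_add, inv_mul_cancel_left₀ hβ.ne']
      exact le_add_self
    exact_mod_cast this
  calc wDist (fun y => (V y : ℝ≥0∞)) (stepLaw P n x) (stepLaw P n y)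
      ≤ (β⁻¹ : ℝ≥0) * wDist w (stepLaw P n x) (stepLaw P n y) := by
        rw [← wDist_const_mul]
        exact wDist_mono hVw _ _
    _ ≤ (β⁻¹ : ℝ≥0) * (ρ ^ k * (D * V x + D * V y)) := by gcongr
    _ ≤ (β⁻¹ : ℝ≥0) * (((ρ⁻¹ * r ^ n : ℝ≥0) : ℝ≥0∞) * (D * V x + D * V y)) := by
        gcongr
        exact_mod_cast hk
    _ = _ := by push_cast; ring

/-- Exponential forgetting produces an invariant law: the iterates from any fixed state form a
Cauchy sequence in the weighted distance. -/
theorem exists_invariant_wDist_le {P : S → PMF S} {V : S → ℝ≥0} (hV : ∀ x, 1 ≤ V x)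
    {C r : ℝ≥0} (hr1 : r < 1)
    (hforget : ∀ (n : ℕ) x y, wDist (fun y => (V y : ℝ≥0∞)) (stepLaw P n x) (stepLaw P n y)
        ≤ C * r ^ n * (V x + V y)) (x₀ : S)
    (hstep : ∑' y, P x₀ y * (V y : ℝ≥0∞) ≠ ∞) :
    ∃ π : PMF S, IsInvariantLaw P π ∧ ∃ R : ℝ≥0, ∀ x n,
      wDist (fun y => (V y : ℝ≥0∞)) (stepLaw P n x) π ≤ R * r ^ n * V x := by
  set w : S → ℝ≥0∞ := fun y => (V y : ℝ≥0∞) with hw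
  have hw1 : ∀ y, 1 ≤ w y := fun y => ENNReal.one_le_coe_iff.2 (hV y)
  set a : ℕ → PMF S := fun n => stepLaw P n x₀ with ha
  have ha_succ : ∀ n, a (n + 1) = (a n).bind P := fun n => by
    simp only [ha]
    rw [stepLaw_add]
    congr 1
    funext y
    exact PMF.bind_pure _
  obtain ⟨M, hM⟩ : ∃ M : ℝ≥0, ∑' y, P x₀ y * (V y : ℝ≥0∞) = M :=
    ⟨_, (ENNReal.coe_toNNReal hstep).symm⟩
  set B : ℝ≥0 := C * (V x₀ + M) with hB
  have hinc : ∀ n, wDist w (a n) (a (n + 1)) ≤ (B * r ^ n : ℝ≥0) := fun n => by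
    calc wDist w (a n) (a (n + 1))
        ≤ ∑' v, P x₀ v * wDist w (a n) (stepLaw P n v) := wDist_bind_le _ _ _ _
      _ ≤ ∑' v, P x₀ v * (C * r ^ n * (V x₀ + V v)) :=
          ENNReal.tsum_le_tsum fun v => mul_le_mul_right (hforget n x₀ v) _
      _ = (B * r ^ n : ℝ≥0) := by
          simp_rw [mul_left_comm (P x₀ _)]
          rw [ENNReal.tsum_mul_left]
          simp_rw [mul_add]
          rw [ENNReal.tsum_add, hM, ENNReal.tsum_mul_right, PMF.tsum_coe, hB]
          push_cast
          ring
  have hr1' : (r : ℝ) < 1 := by exact_mod_cast hr1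
  set B' : ℝ≥0 := B / (1 - r) with hB'
  have hdist : ∀ n k, wDist w (a n) (a (n + k)) ≤ (B' * r ^ n : ℝ≥0) := fun n k => by
    have h1 : wDist w (a n) (a (n + k)) ≤
        ((∑ i ∈ Finset.range k, B * r ^ (n + i) : ℝ≥0) : ℝ≥0∞) := by
      induction k with
      | zero => simp [wDist_self]
      | succ k ih =>
        rw [Finset.sum_range_succ, ENNReal.coe_add]
        exact (wDist_triangle _ _ (a (n + k)) _).trans (add_le_add ih (hinc _))
    refine h1.trans (ENNReal.coe_le_coe.2 ?_)
    have h2 : (∑ i ∈ Finset.range k, r ^ i) ≤ (1 - r)⁻¹ := by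
      rw [← NNReal.tsum_geometric hr1]
      exact (NNReal.summable_geometric hr1).sum_le_tsum _ (fun _ _ => zero_le)
    calc ∑ i ∈ Finset.range k, B * r ^ (n + i) = B * r ^ n * ∑ i ∈ Finset.range k, r ^ i := by
          rw [Finset.mul_sum]
          exact Finset.sum_congr rfl fun i _ => by ring
      _ ≤ B * r ^ n * (1 - r)⁻¹ := by gcongr
      _ = B' * r ^ n := by rw [hB', div_eq_mul_inv]; ring
  -- the weight is at least one, so the weighted Cauchy property gives pointwise limits
  have hlim : ∀ y, ∃ l : ℝ≥0, Tendsto (fun n => a n y) atTop (𝓝 (l : ℝ≥0∞)) := fun y => by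
    have hc : CauchySeq fun n => (a n y).toReal := by
      refine cauchySeq_of_le_geometric (r := (r : ℝ)) (C := (B : ℝ)) hr1' fun n => ?_
      have h1 : (a n y - a (n + 1) y) + (a (n + 1) y - a n y) ≤ (B * r ^ n : ℝ≥0) := by
        refine le_trans ?_ (hinc n)
        refine le_trans ?_ (ENNReal.le_tsum y)
        exact le_mul_of_one_le_left zero_le (hw1 y)
      have hn1 := (a n).apply_ne_top y
      have hn2 := (a (n + 1)).apply_ne_top y
      rw [Real.dist_eq, abs_sub_le_iff]
      have h2 : a n y ≤ a (n + 1) y + (B * r ^ n : ℝ≥0) :=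
        tsub_le_iff_left.1 (le_self_add.trans h1)
      have h3 : a (n + 1) y ≤ a n y + (B * r ^ n : ℝ≥0) :=
        tsub_le_iff_left.1 (le_add_self.trans h1)
      generalize a n y = p at *
      generalize a (n + 1) y = q at *
      lift p to ℝ≥0 using hn1
      lift q to ℝ≥0 using hn2
      have h2' : (p : ℝ) ≤ q + B * r ^ n := by exact_mod_cast h2
      have h3' : (q : ℝ) ≤ p + B * r ^ n := by exact_mod_cast h3
      simp only [ENNReal.coe_toReal]
      constructor <;> linarith
    obtain ⟨l, hl⟩ := cauchySeq_tendsto_of_complete hc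
    have hl0 : 0 ≤ l := ge_of_tendsto' hl fun n => ENNReal.toReal_nonneg
    lift l to ℝ≥0 using hl0
    refine ⟨l, ?_⟩
    have := ENNReal.tendsto_ofReal hl
    simpa [ENNReal.ofReal_toReal ((a _).apply_ne_top y)] using this
  choose p hp using hlim
  have hap : ∀ n, wDist w (a n) (fun y => (p y : ℝ≥0∞)) ≤ (B' * r ^ n : ℝ≥0) := fun n =>
    wDist_le_of_tendsto (fun y => ENNReal.coe_ne_top) (fun y => (a n).apply_ne_top y)
      (fun y => ENNReal.coe_ne_top) hp
      ((eventually_ge_atTop n).mono fun k hk => by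
        obtain ⟨j, rfl⟩ := Nat.exists_eq_add_of_le hk
        exact hdist n j)
  have hsmall : Tendsto (fun n => ((B' * r ^ n : ℝ≥0) : ℝ≥0∞)) atTop (𝓝 0) := by
    have : Tendsto (fun n => B' * r ^ n) atTop (𝓝 (B' * 0)) :=
      (tendsto_pow_atTop_nhds_zero_of_lt_one zero_le hr1).const_mul _
    rw [mul_zero] at this
    rw [← ENNReal.coe_zero]
    exact ENNReal.tendsto_coe.2 this
  have hsum : ∑' y, (p y : ℝ≥0∞) = 1 := by
    have hle : ∀ n, ∑' y, (p y : ℝ≥0∞) ≤ 1 + (B' * r ^ n : ℝ≥0) := fun n => by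
      have h := tsum_mul_le_add_wDist hw1 (fun y => (p y : ℝ≥0∞)) (a n)
      simp only [mul_one, PMF.tsum_coe] at h
      rw [wDist_comm] at h
      exact h.trans (add_le_add le_rfl (hap n))
    have hge : ∀ n, 1 ≤ ∑' y, (p y : ℝ≥0∞) + (B' * r ^ n : ℝ≥0) := fun n => by
      have h := tsum_mul_le_add_wDist hw1 (a n) (fun y => (p y : ℝ≥0∞))
      simp only [mul_one, PMF.tsum_coe] at h
      exact h.trans (add_le_add le_rfl (hap n))
    refine le_antisymm ?_ ?_
    · have h := (tendsto_const_nhds (x := (1 : ℝ≥0∞))).add hsmall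
      rw [add_zero] at h
      exact ge_of_tendsto' h hle
    · have h := (tendsto_const_nhds (x := ∑' y, (p y : ℝ≥0∞))).add hsmall
      rw [add_zero] at h
      exact ge_of_tendsto' h hge
  let π : PMF S := ⟨fun y => p y, hsum ▸ ENNReal.summable.hasSum⟩
  have hπ : ∀ y, π y = p y := fun y => rfl
  refine ⟨π, ?_, C + C * V x₀ + B', fun x n => ?_⟩
  · refine PMF.ext fun y => ?_
    have hPw : ∀ u, P u y ≤ w u := fun u => ((P u).coe_le_one y).trans (hw1 u)
    have h1 : ∀ n, π.bind P y ≤ a (n + 1) y + (B' * r ^ n : ℝ≥0) := fun n => by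
      have h := tsum_mul_le_add_wDist hPw π (a n)
      rw [wDist_comm] at h
      rw [ha_succ, PMF.bind_apply, PMF.bind_apply]
      exact h.trans (add_le_add le_rfl (hap n))
    have h2 : ∀ n, a (n + 1) y ≤ π.bind P y + (B' * r ^ n : ℝ≥0) := fun n => by
      have h := tsum_mul_le_add_wDist hPw (a n) π
      rw [ha_succ, PMF.bind_apply, PMF.bind_apply]
      exact h.trans (add_le_add le_rfl (hap n))
    have h3 : Tendsto (fun n => a (n + 1) y) atTop (𝓝 (π y)) :=
      (hp y).comp (tendsto_add_atTop_nat 1)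
    refine le_antisymm ?_ ?_
    · have h := h3.add hsmall
      rw [add_zero] at h
      exact ge_of_tendsto' h h1
    · have h := (tendsto_const_nhds (x := π.bind P y)).add hsmall
      rw [add_zero] at h
      exact le_of_tendsto_of_tendsto' h3 h h2
  · calc wDist w (stepLaw P n x) π
        ≤ wDist w (stepLaw P n x) (a n) + wDist w (a n) π := wDist_triangle _ _ _ _
      _ ≤ C * r ^ n * (V x + V x₀) + (B' * r ^ n : ℝ≥0) := add_le_add (hforget n x x₀) (hap n)
      _ ≤ _ := by
          have : C * r ^ n * (V x + V x₀) + B' * r ^ n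
              ≤ (C + C * V x₀ + B') * r ^ n * V x := by
            have h := hV x
            calc C * r ^ n * (V x + V x₀) + B' * r ^ n
                = C * r ^ n * V x + (C * V x₀ + B') * r ^ n * 1 := by ring
              _ ≤ C * r ^ n * V x + (C * V x₀ + B') * r ^ n * V x := by gcongr
              _ = _ := by ring
          exact_mod_cast this

end Ergodicity

/-! ### Harris recurrence -/

section Harris

variable {S : Type*}

theorem lintegral_toMeasure [Countable S] (μ : PMF S) (h : S → ℝ≥0∞) :
    letI : MeasurableSpace S := ⊤
    ∫⁻ y, h y ∂μ.toMeasure = ∑' y, μ y * h y := by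
  let _ : MeasurableSpace S := ⊤
  have : MeasurableSingletonClass S := ⟨fun _ => trivial⟩
  rw [lintegral_countable']
  refine tsum_congr fun y => ?_
  rw [PMF.toMeasure_apply_singleton _ _ (measurableSet_singleton y), mul_comm]

open Classical in
/-- `avoidProb P x₀ n x` is the probability that the chain started at `x` is never at `x₀` during
the times `0, …, n`. -/
noncomputable def avoidProb (P : S → PMF S) (x₀ : S) : ℕ → S → ℝ≥0∞
  | 0, x => if x = x₀ then 0 else 1
  | n + 1, x => if x = x₀ then 0 else ∑' y, P x y * avoidProb P x₀ n y

theorem avoidProb_le_one (P : S → PMF S) (x₀ : S) (n : ℕ) (x : S) : avoidProb P x₀ n x ≤ 1 := by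
  induction n generalizing x with
  | zero => unfold avoidProb; split_ifs <;> simp
  | succ n ih =>
    unfold avoidProb
    split_ifs
    · exact zero_le
    · calc ∑' y, P x y * avoidProb P x₀ n y ≤ ∑' y, P x y * 1 :=
            ENNReal.tsum_le_tsum fun y => mul_le_mul_right (ih y) _
        _ = 1 := by simp [PMF.tsum_coe]

theorem avoidProb_antitone (P : S → PMF S) (x₀ : S) : Antitone (avoidProb P x₀) := by
  refine antitone_nat_of_succ_le fun n => ?_
  induction n with
  | zero =>
    intro x
    by_cases hx : x = x₀
    · simp [avoidProb, hx]
    · exact (avoidProb_le_one P x₀ 1 x).trans (by simp [avoidProb, hx])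
  | succ n ih =>
    intro x
    rw [avoidProb, avoidProb]
    split_ifs
    · exact le_rfl
    · exact ENNReal.tsum_le_tsum fun y => mul_le_mul_right (ih y) _

theorem iInf_avoidProb_le [Countable S] (P : S → PMF S) (x₀ x : S) :
    ⨅ n, avoidProb P x₀ n x ≤ ∑' y, P x y * ⨅ n, avoidProb P x₀ n y := by
  let _ : MeasurableSpace S := ⊤
  have hlim : ∑' y, P x y * ⨅ n, avoidProb P x₀ n y = ⨅ n, ∑' y, P x y * avoidProb P x₀ n y := by
    simp_rw [← lintegral_toMeasure]
    refine lintegral_iInf (fun n => measurable_from_top) (avoidProb_antitone P x₀) ?_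
    rw [lintegral_toMeasure]
    refine ne_top_of_le_ne_top ENNReal.one_ne_top ?_
    calc ∑' y, P x y * avoidProb P x₀ 0 y ≤ ∑' y, P x y * 1 :=
          ENNReal.tsum_le_tsum fun y => mul_le_mul_right (avoidProb_le_one P x₀ 0 y) _
      _ = 1 := by simp [PMF.tsum_coe]
  rw [hlim]
  refine le_iInf fun n => (iInf_le _ (n + 1)).trans ?_
  rw [avoidProb]
  split_ifs
  · exact zero_le
  · exact le_rfl

/-- A bounded subharmonic function that vanishes at a state charged by the limit law vanishes
everywhere: it is at most its mean `c` under the limit law `π`, whence `c ≤ c * (1 - π x₀)`. -/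
theorem subharmonic_eq_zero {P : S → PMF S} {π : PMF S} {x₀ : S} (hx₀ : π x₀ ≠ 0)
    (hconv : ∀ x, Tendsto (fun n => wDist 1 (stepLaw P n x) π) atTop (𝓝 0))
    {g : S → ℝ≥0∞} (hg1 : ∀ x, g x ≤ 1) (hg : ∀ x, g x ≤ ∑' y, P x y * g y) (hg0 : g x₀ = 0)
    (x : S) : g x = 0 := by
  have hiter : ∀ n x, g x ≤ ∑' y, stepLaw P n x y * g y := fun n => by
    induction n with
    | zero => intro x; simp [stepLaw]
    | succ n ih =>
      intro x
      simp only [stepLaw]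
      rw [tsum_bind_mul]
      exact (hg x).trans (ENNReal.tsum_le_tsum fun u => mul_le_mul_right (ih u) _)
  set c := ∑' y, π y * g y with hc
  have hgc : ∀ x, g x ≤ c := fun x => by
    have h := (tendsto_const_nhds (x := c)).add (hconv x)
    rw [add_zero] at h
    exact ge_of_tendsto' h fun n => (hiter n x).trans (tsum_mul_le_add_wDist hg1 _ _)
  have hc1 : c ≤ 1 := by
    calc c ≤ ∑' y, π y * 1 := ENNReal.tsum_le_tsum fun y => mul_le_mul_right (hg1 y) _
      _ = 1 := by simp [PMF.tsum_coe]
  have hcc : c + π x₀ * c ≤ c := by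
    classical
    have h1 : π x₀ * c = ∑' y, if y = x₀ then π x₀ * c else 0 := by
      rw [tsum_ite_eq]
    calc c + π x₀ * c = ∑' y, (π y * g y + if y = x₀ then π x₀ * c else 0) := by
          rw [ENNReal.tsum_add, ← h1]
      _ ≤ ∑' y, π y * c := by
          refine ENNReal.tsum_le_tsum fun y => ?_
          split_ifs with hy
          · rw [hy, hg0, mul_zero, zero_add]
          · rw [add_zero]
            exact mul_le_mul_right (hgc y) _
      _ = c := by rw [ENNReal.tsum_mul_right, PMF.tsum_coe, one_mul]
  have hc0 : π x₀ * c = 0 := by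
    have hfin : c ≠ ∞ := ne_top_of_le_ne_top ENNReal.one_ne_top hc1
    have : c + π x₀ * c ≤ c + 0 := by rwa [add_zero]
    exact le_antisymm ((ENNReal.add_le_add_iff_left hfin).1 this) zero_le
  have : c = 0 := (mul_eq_zero.1 hc0).resolve_left hx₀
  exact le_antisymm ((hgc x).trans this.le) zero_le

theorem isProbabilityMeasure_pathLaw (P : S → PMF S) (x : S) :
    letI : MeasurableSpace S := ⊤
    IsProbabilityMeasure (pathLaw P x) := by
  let _ : MeasurableSpace S := ⊤
  have := isMarkovKernel_chainKernel P
  unfold pathLaw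
  infer_instance

/-- Markov property of the path law: given the past up to time `n`, the next state has law
`P (ω n)`. -/
theorem setLIntegral_pathLaw_succ [Countable S] (P : S → PMF S) (x : S) (n : ℕ)
    (A : Set ((i : Finset.Iic n) → S)) (h : S → ℝ≥0∞) :
    letI : MeasurableSpace S := ⊤
    MeasurableSet A →
    ∫⁻ ω in {ω : ℕ → S | Preorder.frestrictLe n ω ∈ A}, h (ω (n + 1)) ∂pathLaw P x =
      ∫⁻ ω in {ω : ℕ → S | Preorder.frestrictLe n ω ∈ A}, ∑' y, P (ω n) y * h y ∂pathLaw P x := by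
  let _ : MeasurableSpace S := ⊤
  intro hA
  have := isMarkovKernel_chainKernel P
  have hprob := isProbabilityMeasure_pathLaw P x
  have hcomp := Kernel.map_frestrictLe_trajMeasure_compProd_eq_map_trajMeasure
    (X := fun _ : ℕ => S) (μ₀ := Measure.dirac x) (a := n)
    (κ := fun n => (chainKernel P).comap
      (fun h : (i : Finset.Iic n) → S => h ⟨n, Finset.mem_Iic.2 le_rfl⟩)
      (measurable_pi_apply _))
  have hh : Measurable h := measurable_from_top
  have hS : MeasurableSet {ω : ℕ → S | Preorder.frestrictLe n ω ∈ A} :=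
    Preorder.measurable_frestrictLe n hA
  have hF : Measurable fun z : ((i : Finset.Iic n) → S) × S =>
      (Prod.fst ⁻¹' A).indicator (fun z => h z.2) z :=
    (hh.comp measurable_snd).indicator (measurable_fst hA)
  have hint := congrArg (fun ν => ∫⁻ z, (Prod.fst ⁻¹' A).indicator (fun z => h z.2) z ∂ν) hcomp
  rw [Measure.lintegral_compProd hF, lintegral_map hF (by fun_prop),
    lintegral_map (by fun_prop) (by fun_prop)] at hint
  rw [← lintegral_indicator hS, ← lintegral_indicator hS]
  refine Eq.trans ?_ (hint.symm.trans ?_)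
  · rfl
  · refine lintegral_congr fun ω => ?_
    by_cases hω : Preorder.frestrictLe n ω ∈ A
    · have hω' : ω ∈ {ω : ℕ → S | Preorder.frestrictLe n ω ∈ A} := hω
      rw [Set.indicator_of_mem hω', ← lintegral_toMeasure]
      refine lintegral_congr fun y => ?_
      exact Set.indicator_of_mem (show (Preorder.frestrictLe n ω, y) ∈ Prod.fst ⁻¹' A from hω) _
    · have hω' : ω ∉ {ω : ℕ → S | Preorder.frestrictLe n ω ∈ A} := hω
      rw [Set.indicator_of_notMem hω']
      refine (lintegral_congr fun y => ?_).trans lintegral_zero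
      exact Set.indicator_of_notMem
        (show (Preorder.frestrictLe n ω, y) ∉ Prod.fst ⁻¹' A from hω) _

theorem pathLaw_forall_ge_ne_le [Countable S] (P : S → PMF S) (x₀ x : S) (N n k : ℕ) (hk : N ≤ k) :
    letI : MeasurableSpace S := ⊤
    pathLaw P x {ω | ∀ i, N ≤ i → ω i ≠ x₀} ≤
      ∫⁻ ω in {ω : ℕ → S | ∀ i, N ≤ i → i < k → ω i ≠ x₀}, avoidProb P x₀ n (ω k)
        ∂pathLaw P x := by
  let _ : MeasurableSpace S := ⊤
  have hne : ∀ i : ℕ, MeasurableSet {ω : ℕ → S | ω i ≠ x₀} := fun i =>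
    (measurable_pi_apply (X := fun _ : ℕ => S) i) (t := {y : S | y ≠ x₀}) trivial
  have hE : ∀ k, MeasurableSet {ω : ℕ → S | ∀ i, N ≤ i → i < k → ω i ≠ x₀} := fun k => by
    simp only [Set.ofPred_forall]
    exact MeasurableSet.iInter fun i => MeasurableSet.iInter fun _ => MeasurableSet.iInter
      fun _ => hne i
  induction n generalizing k with
  | zero =>
    have hm : MeasurableSet {ω : ℕ → S | ∀ i, N ≤ i → ω i ≠ x₀} := by
      simp only [Set.ofPred_forall]
      exact MeasurableSet.iInter fun i => MeasurableSet.iInter fun _ => hne i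
    rw [← lintegral_indicator_one hm, ← lintegral_indicator (hE k)]
    refine lintegral_mono fun ω => ?_
    refine Set.indicator_le (fun ω hω => ?_) ω
    have hω' : ω ∈ {ω : ℕ → S | ∀ i, N ≤ i → i < k → ω i ≠ x₀} := fun i hi _ => hω i hi
    rw [Set.indicator_of_mem hω']
    simp [avoidProb, hω k hk]
  | succ n ih =>
    refine (ih (k + 1) (hk.trans (Nat.le_succ k))).trans (le_of_eq ?_)
    have hset : {ω : ℕ → S | ∀ i, N ≤ i → i < k + 1 → ω i ≠ x₀} =
        {ω : ℕ → S | Preorder.frestrictLe k ω ∈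
          {p : (i : Finset.Iic k) → S | ∀ i : Finset.Iic k, N ≤ (i : ℕ) → p i ≠ x₀}} := by
      ext ω
      constructor
      · intro hω i hi
        exact hω i hi (Nat.lt_succ_of_le (Finset.mem_Iic.1 i.2))
      · intro hω i hi hik
        exact hω ⟨i, Finset.mem_Iic.2 (Nat.le_of_lt_succ hik)⟩ hi
    have hA : MeasurableSet
        {p : (i : Finset.Iic k) → S | ∀ i : Finset.Iic k, N ≤ (i : ℕ) → p i ≠ x₀} := by
      simp only [Set.ofPred_forall]
      exact MeasurableSet.iInter fun i => MeasurableSet.iInter fun _ =>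
        (measurable_pi_apply (X := fun _ : Finset.Iic k => S) i) (t := {y : S | y ≠ x₀}) trivial
    have hstep := setLIntegral_pathLaw_succ P x k _ (avoidProb P x₀ n) hA
    rw [← hset] at hstep
    rw [hstep, ← lintegral_indicator (hE k), ← lintegral_indicator (hE (k + 1))]
    refine lintegral_congr fun ω => ?_
    by_cases hω : ω ∈ {ω : ℕ → S | ∀ i, N ≤ i → i < k → ω i ≠ x₀}
    · rw [Set.indicator_of_mem hω]
      by_cases hωk : ω k = x₀
      · have hω' : ω ∉ {ω : ℕ → S | ∀ i, N ≤ i → i < k + 1 → ω i ≠ x₀} :=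
          fun h => h k hk (Nat.lt_succ_self k) hωk
        rw [Set.indicator_of_notMem hω', avoidProb, if_pos hωk]
      · rw [Set.indicator_of_mem, avoidProb, if_neg hωk]
        intro i hi hik
        rcases (Nat.le_of_lt_succ hik).lt_or_eq with h | rfl
        · exact hω i hi h
        · exact hωk
    · rw [Set.indicator_of_notMem hω, Set.indicator_of_notMem]
      exact fun h => hω fun i hi hik => h i hi (hik.trans (Nat.lt_succ_self k))

/-- A chain whose laws converge to `π` in total variation visits every atom of `π` infinitely
often, hence is Harris recurrent. -/
theorem isHarrisRecurrent_of_tendsto [Countable S] {P : S → PMF S} {π : PMF S}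
    (hconv : ∀ x, Tendsto (fun n => wDist 1 (stepLaw P n x) π) atTop (𝓝 0)) :
    IsHarrisRecurrent P := by
  let _ : MeasurableSpace S := ⊤
  obtain ⟨x₀, hx₀⟩ := π.support_nonempty
  have hx₀ : π x₀ ≠ 0 := (π.mem_support_iff x₀).1 hx₀
  have hzero : ∀ y, ⨅ n, avoidProb P x₀ n y = 0 :=
    subharmonic_eq_zero hx₀ hconv (fun y => (iInf_le _ 0).trans (avoidProb_le_one P x₀ 0 y))
      (iInf_avoidProb_le P x₀)
      (le_antisymm ((iInf_le _ 0).trans (by simp [avoidProb])) zero_le)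
  refine ⟨Measure.dirac x₀, inferInstance, IsProbabilityMeasure.ne_zero _, fun A hA x => ?_⟩
  have hxA : x₀ ∈ A := by
    by_contra h
    rw [Measure.dirac_apply' _ (show MeasurableSet A from trivial), Set.indicator_of_notMem h] at hA
    exact lt_irrefl _ hA
  have hprob := isProbabilityMeasure_pathLaw P x
  have hnull : ∀ N, pathLaw P x {ω | ∀ i, N ≤ i → ω i ≠ x₀} = 0 := fun N => by
    have h1 : ∀ n, pathLaw P x {ω | ∀ i, N ≤ i → ω i ≠ x₀} ≤
        ∫⁻ ω, avoidProb P x₀ n (ω N) ∂pathLaw P x := fun n =>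
      (pathLaw_forall_ge_ne_le P x₀ x N n N le_rfl).trans (setLIntegral_le_lintegral _ _)
    have h2 : ∫⁻ ω, ⨅ n, avoidProb P x₀ n (ω N) ∂pathLaw P x
        = ⨅ n, ∫⁻ ω, avoidProb P x₀ n (ω N) ∂pathLaw P x := by
      refine lintegral_iInf (fun n => ?_) (fun m n hmn ω => avoidProb_antitone P x₀ hmn _) ?_
      · exact (measurable_from_top (f := avoidProb P x₀ n)).comp (measurable_pi_apply N)
      · refine ne_top_of_le_ne_top ENNReal.one_ne_top ?_
        calc ∫⁻ ω, avoidProb P x₀ 0 (ω N) ∂pathLaw P x ≤ ∫⁻ _, 1 ∂pathLaw P x :=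
              lintegral_mono fun ω => avoidProb_le_one P x₀ 0 _
          _ = 1 := by simp
    simp only [hzero, lintegral_zero] at h2
    exact le_antisymm ((le_iInf h1).trans h2.symm.le) zero_le
  have hall : ∀ᵐ ω ∂pathLaw P x, ∀ N, ∃ i, N ≤ i ∧ ω i = x₀ := by
    rw [ae_all_iff]
    intro N
    rw [ae_iff]
    convert hnull N using 3
    push Not
    rfl
  filter_upwards [hall] with ω hω
  rw [frequently_atTop]
  intro N
  obtain ⟨i, hi, hix⟩ := hω N
  exact ⟨i, hi, hix ▸ hxA⟩

end Harris

/-! ### The ergodic theorem for chains with a geometric drift -/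

section GeometricDrift

variable {S : Type*}

/-- Foster-Lyapunov criterion: a geometric drift towards finite sublevel sets of `V`, together with
a state reached at all large times from everywhere, gives convergence to an invariant law at
a geometric rate in the weight `V`, and Harris recurrence. -/
theorem geometric_ergodicity_of_drift [Countable S] {P : S → PMF S} {V : S → ℝ≥0}
    (hV : ∀ x, 1 ≤ V x) {lam b : ℝ≥0} (hlam : lam < 1)
    (drift : ∀ x, ∑' y, P x y * (V y : ℝ≥0∞) ≤ lam * V x + b)
    (hfin : ∀ c : ℝ≥0, {x | V x ≤ c}.Finite) {x₀ : S}
    (hreach : ∀ x, ∃ N, ∀ n ≥ N, stepLaw P n x x₀ ≠ 0) :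
    IsHarrisRecurrent P ∧ ∃ π : PMF S, IsInvariantLaw P π ∧ ∃ r R : ℝ≥0, 0 < r ∧ r < 1 ∧
      ∀ x n, wDist (fun y => (V y : ℝ≥0∞)) (stepLaw P n x) π ≤ R * r ^ n * V x := by
  obtain ⟨C, r, hr0, hr1, hforget⟩ := exists_wDist_stepLaw_le hV hlam drift hfin hreach
  have hstep : ∑' y, P x₀ y * (V y : ℝ≥0∞) ≠ ∞ := by
    refine ne_top_of_le_ne_top ?_ (drift x₀)
    rw [← ENNReal.coe_mul, ← ENNReal.coe_add]
    exact ENNReal.coe_ne_top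
  obtain ⟨π, hπ, R, hR⟩ := exists_invariant_wDist_le hV hr1 hforget x₀ hstep
  refine ⟨isHarrisRecurrent_of_tendsto (π := π) fun x => ?_, π, hπ, r, R, hr0, hr1, hR⟩
  have h0 : Tendsto (fun n => ((R * r ^ n * V x : ℝ≥0) : ℝ≥0∞)) atTop (𝓝 0) := by
    have : Tendsto (fun n => R * r ^ n * V x) atTop (𝓝 (R * 0 * V x)) :=
      ((tendsto_pow_atTop_nhds_zero_of_lt_one zero_le hr1).const_mul _).mul_const _
    rw [mul_zero, zero_mul] at this
    rw [← ENNReal.coe_zero]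
    exact ENNReal.tendsto_coe.2 this
  refine tendsto_of_tendsto_of_tendsto_of_le_of_le tendsto_const_nhds h0 (fun _ => zero_le)
    fun n => ?_
  refine (wDist_mono (fun y => ?_) _ _).trans ((hR x n).trans (le_of_eq (by push_cast; rfl)))
  exact ENNReal.one_le_coe_iff.2 (hV y)

end GeometricDrift

/-! ### Reachability -/

theorem exists_forall_ge_stepLaw_ne_zero {S : Type*} {P : S → PMF S} (hirr : ChainIrreducible P)
    (hap : ChainAperiodic P) (x y : S) : ∃ N, ∀ n ≥ N, stepLaw P n x y ≠ 0 := by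
  let s : AddSubmonoid ℕ :=
    { carrier := {n | stepLaw P n y y ≠ 0}
      add_mem' := fun ha hb => stepLaw_add_ne_zero ha hb
      zero_mem' := by simp [stepLaw] }
  have hgcd : Nat.setGcd (s : Set ℕ) = 1 :=
    hap y _ fun n _ hn => Nat.setGcd_dvd_of_mem (s := (s : Set ℕ)) hn
  obtain ⟨N, hN⟩ := Nat.exists_mem_closure_of_ge (s : Set ℕ)
  obtain ⟨k, hk⟩ := hirr x y
  refine ⟨k + N, fun n hn => ?_⟩
  obtain ⟨j, rfl⟩ := Nat.exists_eq_add_of_le hn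
  have hmem := hN (N + j) (Nat.le_add_right _ _) (hgcd ▸ one_dvd _)
  rw [AddSubmonoid.closure_eq] at hmem
  rw [add_assoc]
  exact stepLaw_add_ne_zero hk hmem

namespace OrderBook

variable {K : ℕ} (M : OrderBook K)

/-- Trajectories of the jump chain, with the price replaced by its last increment, are
trajectories of `Ychain`. -/
theorem exists_stepLaw_Ychain_ne_zero (n : ℕ) {x x' : M.XState}
    (h : stepLaw M.jumpChain n x x' ≠ 0) (c : Increment M.α) :
    ∃ c', stepLaw M.Ychain n (x.1, c) (x'.1, c') ≠ 0 := by
  induction n generalizing x c with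
  | zero =>
    have hx : x' = x := by
      by_contra hne
      exact h (by simp [stepLaw, hne])
    subst hx
    exact ⟨c, by simp [stepLaw]⟩
  | succ n ih =>
    simp only [stepLaw] at h ⊢
    rw [PMF.bind_apply] at h
    obtain ⟨z, hz⟩ : ∃ z, M.jumpChain x z * stepLaw M.jumpChain n z x' ≠ 0 := by
      by_contra hne
      push Not at hne
      exact h (ENNReal.tsum_eq_zero.2 hne)
    obtain ⟨c', hc'⟩ := ih (right_ne_zero_of_mul hz) (increment x.2 z.2)
    refine ⟨c', ?_⟩
    rw [PMF.bind_apply]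
    intro h0
    refine mul_ne_zero ?_ hc' (ENNReal.tsum_eq_zero.1 h0 (z.1, increment x.2 z.2))
    rw [← PMF.mem_support_iff]
    have he : M.Ychain (x.1, c) = M.eventLaw x.1 x.2 := M.eventLaw_eq _ _ _
    rw [he, eventLaw, PMF.mem_support_map_iff]
    exact ⟨z, (PMF.mem_support_iff _ _).2 (left_ne_zero_of_mul hz), rfl⟩

/-- Some state of the chain `Ychain` is eventually reached with positive probability at all times
from every state. It need not be every state: an increment may be impossible. -/
theorem exists_reachable (h : M.IrreducibleAperiodic) (q : Book K) :
    ∃ y₀, ∀ y, ∃ N, ∀ n ≥ N, stepLaw M.Ychain n y y₀ ≠ 0 := by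
  let c₀ : Increment M.α := ⟨0, Or.inr (Or.inl rfl)⟩
  obtain ⟨y₀, hy₀⟩ := (M.Ychain (q, c₀)).support_nonempty
  refine ⟨y₀, fun y => ?_⟩
  obtain ⟨N, hN⟩ := exists_forall_ge_stepLaw_ne_zero h.1 h.2 (y.1, basePrice M.α)
    (q, basePrice M.α)
  refine ⟨N + 1, fun n hn => ?_⟩
  obtain ⟨j, rfl⟩ := Nat.exists_eq_add_of_le hn
  obtain ⟨c', hc'⟩ := M.exists_stepLaw_Ychain_ne_zero (N + j)
    (hN (N + j) (Nat.le_add_right _ _)) y.2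
  rw [show N + 1 + j = N + j + 1 by ring]
  refine stepLaw_add_ne_zero hc' ?_
  have h1 : stepLaw M.Ychain 1 (q, c') = M.Ychain (q, c₀) := PMF.bind_pure _
  rw [h1]
  exact (PMF.mem_support_iff _ _).1 hy₀

end OrderBook

/-! ### The generator of the model -/

namespace OrderBook

variable {K : ℕ} (M : OrderBook K)

open Classical in
theorem tsum_book_ite_mul {a : ℝ≥0∞} {t : Fin (2 * K) → ℤ} (W : (Fin (2 * K) → ℤ) → ℝ≥0∞)
    (h : (¬ ∃ q' : Book K, q'.1 = t) → a = 0) :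
    ∑' q' : Book K, (if q'.1 = t then a else 0) * W q'.1 = a * W t := by
  by_cases ht : ∃ q' : Book K, q'.1 = t
  · obtain ⟨q', rfl⟩ := ht
    rw [tsum_eq_single q', if_pos rfl]
    intro b hb
    rw [if_neg fun h => hb (Subtype.ext h), zero_mul]
  · rw [h ht]
    simp

open Classical in
theorem tsum_book_ite_mul_le (a : ℝ≥0∞) (t : Fin (2 * K) → ℤ)
    (W : (Fin (2 * K) → ℤ) → ℝ≥0∞) :
    ∑' q' : Book K, (if q'.1 = t then a else 0) * W q'.1 ≤ a * W t := by
  by_cases ht : ∃ q' : Book K, q'.1 = t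
  · exact (tsum_book_ite_mul W fun h => absurd ht h).le
  · have : ∀ q' : Book K, q'.1 ≠ t := fun q' hq => ht ⟨q', hq⟩
    simp [this]

variable {M} in
/-- Action of the pure order book jumps on functions of the shape. -/
theorem tsum_pureRate_mul (hM : M.Standing) (W : (Fin (2 * K) → ℤ) → ℝ≥0∞) (q : Book K) :
    ∑' q', M.pureRate q q' * W q'.1 = ∑ i,
      ((∑' n : ℕ+, (M.f i q n : ℝ≥0∞) * W (q.1 + Pi.single i ((n : ℕ) : ℤ))) +
        ∑' n : ℕ+, (M.g i q n : ℝ≥0∞) * W (q.1 - Pi.single i ((n : ℕ) : ℤ))) := by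
  unfold pureRate
  simp_rw [Finset.sum_mul]
  rw [Summable.tsum_finsetSum fun _ _ => ENNReal.summable]
  refine Finset.sum_congr rfl fun i _ => ?_
  simp_rw [← ENNReal.tsum_mul_right]
  rw [ENNReal.tsum_comm, ← ENNReal.tsum_add]
  refine tsum_congr fun n => ?_
  simp_rw [add_mul]
  rw [ENNReal.tsum_add, tsum_book_ite_mul, tsum_book_ite_mul]
  · intro h; exact_mod_cast hM.g_unused i q n h
  · intro h; exact_mod_cast hM.f_unused i q n h

theorem coe_fStar (hM : M.Standing) (i : Fin (2 * K)) (q : Book K) :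
    (M.fStar i q : ℝ≥0∞) = ∑' n, (M.f i q n : ℝ≥0∞) :=
  ENNReal.coe_tsum (hM.f_summable i q)

theorem coe_gStar (hM : M.Standing) (i : Fin (2 * K)) (q : Book K) :
    (M.gStar i q : ℝ≥0∞) = ∑' n, (M.g i q n : ℝ≥0∞) :=
  ENNReal.coe_tsum (hM.g_summable i q)

variable {M} in
theorem tsum_pureRate (hM : M.Standing) (q : Book K) :
    ∑' q', M.pureRate q q' = M.flow q := by
  have h := tsum_pureRate_mul hM (fun _ => 1) q
  simp only [mul_one] at h
  rw [h, flow]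
  push_cast
  exact Finset.sum_congr rfl fun i _ => by rw [M.coe_fStar hM, M.coe_gStar hM]

theorem pureRate_self (q : Book K) : M.pureRate q q = 0 := by
  unfold pureRate
  refine Finset.sum_eq_zero fun i _ => ENNReal.tsum_eq_zero.2 fun n => ?_
  have hn : ((n : ℕ) : ℤ) ≠ 0 := by exact_mod_cast n.ne_zero
  rw [if_neg, if_neg, add_zero]
  · intro h
    have := congrFun h i
    simp only [Pi.sub_apply, Pi.single_eq_same] at this
    omega
  · intro h
    have := congrFun h i
    simp only [Pi.add_apply, Pi.single_eq_same] at this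
    omega

variable {M} in
open Classical in
theorem jumpRate_eq (hM : M.Standing) (x y : M.XState) :
    M.jumpRate x y = (if y.2.1 = x.2.1 then M.pureRate x.1 y.1 else 0) +
      (if y.2.1 = x.2.1 + M.α then M.upRate x.1 y.1 else 0) +
      (if y.2.1 = x.2.1 - M.α then M.downRate x.1 y.1 else 0) := by
  unfold jumpRate
  split_ifs with h h1 h2 h3 h4 h5 <;> try rfl
  all_goals subst h
  all_goals have := hM.α_pos
  all_goals first | (exfalso; linarith) | simp [pureRate_self]

open Classical in
theorem tsum_price_ite {α : ℝ} (p : Price α) (k : ℤ) (a : ℝ≥0∞) :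
    ∑' p' : Price α, (if p'.1 = p.1 + k * α then a else 0) = a := by
  obtain ⟨j, hj⟩ := p.2
  let p₀ : Price α := ⟨p.1 + k * α, j + k, by rw [hj]; push_cast; ring⟩
  rw [tsum_eq_single p₀, if_pos rfl]
  intro p' hp'
  exact if_neg fun h => hp' (Subtype.ext h)

variable {M} in
/-- Action of the generator on functions of the shape. -/
theorem tsum_jumpRate_mul (hM : M.Standing) (x : M.XState) (H : Book K → ℝ≥0∞) :
    ∑' y : M.XState, M.jumpRate x y * H y.1 =
      ∑' q', (M.pureRate x.1 q' + M.upRate x.1 q' + M.downRate x.1 q') * H q' := by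
  classical
  simp_rw [jumpRate_eq hM]
  refine ENNReal.tsum_prod'.trans (tsum_congr fun q' => ?_)
  have h0 := tsum_price_ite x.2 0 (M.pureRate x.1 q')
  have h1 := tsum_price_ite x.2 1 (M.upRate x.1 q')
  have h2 := tsum_price_ite x.2 (-1) (M.downRate x.1 q')
  simp only [Int.cast_zero, zero_mul, add_zero, Int.cast_one, one_mul, Int.cast_neg, neg_mul,
    ← sub_eq_add_neg] at h0 h1 h2
  refine ENNReal.tsum_mul_right.trans (congrArg (· * H q') ?_)
  exact ENNReal.tsum_add.trans
    (congrArg₂ (· + ·) (ENNReal.tsum_add.trans (congrArg₂ (· + ·) h0 h1)) h2)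

variable {M} in
theorem exitRate_eq (hM : M.Standing) (x : M.XState) :
    M.exitRate x = ((M.flow x.1 + M.u x.1 + M.d x.1 : ℝ≥0) : ℝ≥0∞) := by
  have h := tsum_jumpRate_mul hM x (fun _ => 1)
  simp only [mul_one] at h
  rw [exitRate, h, ENNReal.tsum_add, ENNReal.tsum_add, tsum_pureRate hM, hM.up_total,
    hM.down_total]
  push_cast
  rfl

variable {M} in
/-- One step of `Ychain`, seen through functions of the shape, normalizes the generator by the
total jump rate. -/
theorem tsum_Ychain_mul (hM : M.Standing) (x : M.YState) (H : Book K → ℝ≥0∞) :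
    ∑' y : M.YState, M.Ychain x y * H y.1 =
      (∑' q', (M.pureRate x.1 q' + M.upRate x.1 q' + M.downRate x.1 q') * H q') *
        ((M.flow x.1 + M.u x.1 + M.d x.1 : ℝ≥0) : ℝ≥0∞)⁻¹ := by
  have hx := exitRate_eq hM (x.1, basePrice M.α)
  have hpos : M.exitRate (x.1, basePrice M.α) ≠ 0 := by
    rw [hx]
    have := hM.flow_pos x.1
    exact_mod_cast (by positivity : (0 : ℝ≥0) < M.flow x.1 + M.u x.1 + M.d x.1).ne'
  have htop : M.exitRate (x.1, basePrice M.α) ≠ ∞ := by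
    rw [hx]
    exact ENNReal.coe_ne_top
  rw [← tsum_jumpRate_mul hM (x.1, basePrice M.α) H, ← hx, ← ENNReal.tsum_mul_right]
  have hchain : M.Ychain x = (M.jumpChain (x.1, basePrice M.α)).bind fun z =>
      PMF.pure (z.1, increment (basePrice M.α) z.2) := rfl
  rw [hchain, tsum_bind_mul]
  refine tsum_congr fun z => ?_
  rw [tsum_pure_mul, jumpChain, dif_pos ⟨hpos, htop⟩, PMF.normalize_apply, mul_right_comm]

end OrderBook

/-! ### Drift of a single queue -/

section SizeGen

/-- Generating function of the sizes whose rates are `h`. -/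
noncomputable def sizeGen (h : ℕ+ → ℝ≥0) (z : ℝ≥0) : ℝ≥0∞ :=
  ∑' n : ℕ+, ((z ^ (n : ℕ) * (h n / ∑' m, h m) : ℝ≥0) : ℝ≥0∞)

theorem tsum_mul_sizeGen {h : ℕ+ → ℝ≥0} (hh : Summable h) (z : ℝ≥0) :
    ((∑' n, h n : ℝ≥0) : ℝ≥0∞) * sizeGen h z = ∑' n : ℕ+, (h n : ℝ≥0∞) * (z : ℝ≥0∞) ^ (n : ℕ) := by
  unfold sizeGen
  rw [← ENNReal.tsum_mul_left]
  refine tsum_congr fun n => ?_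
  have hle : h n ≤ ∑' m, h m := hh.le_tsum' n
  have : (∑' m, h m) * (z ^ (n : ℕ) * (h n / ∑' m, h m)) = h n * z ^ (n : ℕ) := by
    rcases eq_or_ne (∑' m, h m) 0 with h0 | h0
    · have : h n = 0 := le_antisymm (h0 ▸ hle) zero_le
      rw [this]
      simp
    · field_simp
  rw [← ENNReal.coe_mul, this]
  push_cast
  rfl

theorem sizeGen_le_one {h : ℕ+ → ℝ≥0} (hh : Summable h) {z : ℝ≥0} (hz : z ≤ 1) :
    sizeGen h z ≤ 1 := by
  have hsum : sizeGen h 1 ≤ 1 := by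
    have hdiv : Summable fun n => h n / ∑' m, h m := hh.div_const _
    unfold sizeGen
    simp only [one_pow, one_mul]
    rw [← ENNReal.coe_tsum hdiv, tsum_div_const]
    exact_mod_cast div_self_le_one _
  refine le_trans (ENNReal.tsum_le_tsum fun n => ENNReal.coe_le_coe.2 ?_) hsum
  gcongr

/-- A queue with insertion rates `h` and removal rates `k` that satisfies the drift condition:
its weight decreases at a rate proportional to the total flow `F`. -/
theorem sizeGen_drift {h k : ℕ+ → ℝ≥0} (hh : Summable h) (hk : Summable k) {z F : ℝ≥0}
    (hz : 1 < z) (hF : 0 < F) (hfin : sizeGen h z ≠ ∞) {r δ : ℝ≥0} (hδ0 : 0 < δ)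
    (hδ : (δ : ℝ) ≤ (sizeGen h z).toReal - 1)
    (hdrift : (((∑' n, h n) / F : ℝ≥0) : ℝ) - (((∑' n, k n) / F : ℝ≥0) : ℝ) *
      ((1 - (sizeGen k z⁻¹).toReal) / ((sizeGen h z).toReal - 1)) ≤ -r) :
    (∑' n : ℕ+, (h n : ℝ≥0∞) * (z : ℝ≥0∞) ^ (n : ℕ)) +
      (∑' n : ℕ+, (k n : ℝ≥0∞) * ((z⁻¹ : ℝ≥0) : ℝ≥0∞) ^ (n : ℕ)) + F * (r * δ) ≤
      ((∑' n, h n : ℝ≥0) : ℝ≥0∞) + ((∑' n, k n : ℝ≥0) : ℝ≥0∞) := by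
  rw [← tsum_mul_sizeGen hh, ← tsum_mul_sizeGen hk]
  have hkfin : sizeGen k z⁻¹ ≠ ∞ :=
    ne_top_of_le_ne_top ENNReal.one_ne_top (sizeGen_le_one hk (inv_le_one_of_one_le₀ hz.le))
  generalize sizeGen h z = A at *
  generalize sizeGen k z⁻¹ = B at *
  generalize (∑' n, h n) = a at *
  generalize (∑' n, k n) = b at *
  lift A to ℝ≥0 using hfin
  lift B to ℝ≥0 using hkfin
  simp only [ENNReal.coe_toReal] at hδ hdrift
  have hδ0' : (0 : ℝ) < δ := by exact_mod_cast hδ0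
  have hF' : (0 : ℝ) < F := by exact_mod_cast hF
  have hA : (0 : ℝ) < (A : ℝ) - 1 := by linarith
  push_cast at hdrift
  have h1 : (a : ℝ) * (A - 1) - b * (1 - B) ≤ -r * (F * (A - 1)) := by
    have := mul_le_mul_of_nonneg_right hdrift (mul_pos hF' hA).le
    have e : ((a : ℝ) / F - b / F * ((1 - B) / (A - 1))) * (F * (A - 1))
        = a * (A - 1) - b * (1 - B) := by
      field_simp
    rwa [e] at this
  have h2 : (F : ℝ) * (r * δ) ≤ r * (F * (A - 1)) := by
    have := mul_le_mul_of_nonneg_left hδ (mul_nonneg hF'.le r.coe_nonneg)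
    linarith
  have : (a : ℝ) * A + b * B + F * (r * δ) ≤ a + b := by linarith
  exact_mod_cast this

end SizeGen

namespace OrderBook

variable {K : ℕ} {M : OrderBook K}

theorem zpow_le_of_abs_le {U : ℝ} {z : ℝ≥0} (hz : 1 ≤ z) {m m' : ℤ} {n : ℕ}
    (h : |m'| ≤ |m| + n) : zpow U z m' ≤ z ^ n * zpow U z m := by
  have hz0 : z ≠ 0 := (zero_lt_one.trans_le hz).ne'
  unfold zpow
  rw [← NNReal.rpow_natCast, ← NNReal.rpow_add hz0]
  refine NNReal.rpow_le_rpow_of_exponent_le hz ?_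
  have : |(m' : ℝ)| ≤ |(m : ℝ)| + n := by exact_mod_cast h
  linarith

theorem zpow_le_of_abs_add_le {U : ℝ} {z : ℝ≥0} (hz : 1 ≤ z) {m m' : ℤ} {n : ℕ}
    (h : |m'| + n ≤ |m|) : zpow U z m' ≤ z⁻¹ ^ n * zpow U z m := by
  have hz0 : z ≠ 0 := (zero_lt_one.trans_le hz).ne'
  unfold zpow
  rw [inv_pow, ← NNReal.rpow_natCast, ← NNReal.rpow_neg, ← NNReal.rpow_add hz0]
  refine NNReal.rpow_le_rpow_of_exponent_le hz ?_
  have : |(m' : ℝ)| + n ≤ |(m : ℝ)| := by exact_mod_cast h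
  linarith

theorem zpow_le_one {U : ℝ} {z : ℝ≥0} (hz : 1 ≤ z) {m : ℤ} (h : |(m : ℝ)| ≤ U) :
    zpow U z m ≤ 1 :=
  NNReal.rpow_le_one_of_one_le_of_nonpos hz (by linarith)

theorem zpow_pos {U : ℝ} {z : ℝ≥0} (hz : 0 < z) (m : ℤ) : 0 < zpow U z m :=
  NNReal.rpow_pos hz

theorem bestAsk_le_of_pos {q : Fin (2 * K) → ℤ} {i : Fin (2 * K)} (h : 0 < q i) :
    bestAsk q ≤ i :=
  Finset.min_le (by simpa using h)

theorem le_bestBid_of_neg {q : Fin (2 * K) → ℤ} {i : Fin (2 * K)} (h : q i < 0) :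
    (i : WithBot (Fin (2 * K))) ≤ bestBid q :=
  Finset.le_max (by simpa using h)

theorem tsum_rate_mul_le {h : ℕ+ → ℝ≥0} {φ : ℕ+ → ℝ≥0} {t v : ℝ≥0}
    (hφ : ∀ n, h n ≠ 0 → φ n ≤ t ^ (n : ℕ) * v) :
    ∑' n, (h n : ℝ≥0∞) * φ n ≤ (∑' n : ℕ+, (h n : ℝ≥0∞) * (t : ℝ≥0∞) ^ (n : ℕ)) * v := by
  rw [← ENNReal.tsum_mul_right]
  refine ENNReal.tsum_le_tsum fun n => ?_
  by_cases hn : h n = 0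
  · simp [hn]
  · rw [mul_assoc]
    exact mul_le_mul_right (by exact_mod_cast hφ n hn) _

/-- The consequences of the assumptions at a fixed base `z` of the weight that enter the drift of
a queue. -/
structure QueueBounds (M : OrderBook K) (U : ℝ) (z r δ L : ℝ≥0) : Prop where
  one_lt : 1 < z
  δ_pos : 0 < δ
  Gf_ne_top : ∀ i q, M.Gf i q z ≠ ∞
  Gg_ne_top : ∀ i q, M.Gg i q z ≠ ∞
  ask_size : ∀ (q : Book K) (i : Fin (2 * K)), U < q.1 i → (δ : ℝ) ≤ (M.Gf i q z).toReal - 1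
  bid_size : ∀ (q : Book K) (i : Fin (2 * K)), (q.1 i : ℝ) < -U →
    (δ : ℝ) ≤ (M.Gg i q z).toReal - 1
  ask_drift : ∀ (q : Book K) (i : Fin (2 * K)), U < q.1 i → (M.aStar i q : ℝ) - M.bStar i q *
    ((1 - (M.Gg i q z⁻¹).toReal) / ((M.Gf i q z).toReal - 1)) ≤ -r
  bid_drift : ∀ (q : Book K) (i : Fin (2 * K)), (q.1 i : ℝ) < -U →
    (M.bStar i q : ℝ) - M.aStar i q *
    ((1 - (M.Gf i q z⁻¹).toReal) / ((M.Gg i q z).toReal - 1)) ≤ -r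
  ask_insert : ∀ (q : Book K) (i : Fin (2 * K)), bestBid q.1 < (i : WithBot (Fin (2 * K))) →
    (M.aStar i q : ℝ≥0∞) * M.Gf i q z ≤ L
  bid_insert : ∀ (q : Book K) (i : Fin (2 * K)), (i : WithTop (Fin (2 * K))) < bestAsk q.1 →
    (M.bStar i q : ℝ≥0∞) * M.Gg i q z ≤ L

/-- Rate of change of the weight of the queue `i` under the pure order book jumps. -/
theorem queue_drift (hM : M.Standing) (h_sign : M.NoSignReversal) {U : ℝ} (hU : 1 < U)
    {z r δ L : ℝ≥0} (hb : M.QueueBounds U z r δ L) (q : Book K) (i : Fin (2 * K)) :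
    (∑' n : ℕ+, (M.f i q n : ℝ≥0∞) * zpow U z (q.1 i + (n : ℕ))) +
      (∑' n : ℕ+, (M.g i q n : ℝ≥0∞) * zpow U z (q.1 i - (n : ℕ))) +
      M.flow q * (r * δ * zpow U z (q.1 i)) ≤
    (M.fStar i q + M.gStar i q) * zpow U z (q.1 i) + M.flow q * (2 * L + r * δ) := by
  have hz := hb.one_lt.le
  have hF := hM.flow_pos q
  have hfs := hM.f_summable i q
  have hgs := hM.g_summable i q
  set v := zpow U z (q.1 i) with hv
  rcases lt_or_ge U |(q.1 i : ℝ)| with hlarge | hsmall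
  · rcases lt_abs.1 hlarge with hpos | hneg
    · have hpos' : 0 < q.1 i := by exact_mod_cast (by linarith : (0 : ℝ) < q.1 i)
      have hf : ∑' n : ℕ+, (M.f i q n : ℝ≥0∞) * zpow U z (q.1 i + (n : ℕ)) ≤
          (∑' n : ℕ+, (M.f i q n : ℝ≥0∞) * (z : ℝ≥0∞) ^ (n : ℕ)) * v :=
        tsum_rate_mul_le fun n _ => zpow_le_of_abs_le hz (by
          refine (abs_add_le _ _).trans (le_of_eq ?_); simp)
      have hg : ∑' n : ℕ+, (M.g i q n : ℝ≥0∞) * zpow U z (q.1 i - (n : ℕ)) ≤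
          (∑' n : ℕ+, (M.g i q n : ℝ≥0∞) * ((z⁻¹ : ℝ≥0) : ℝ≥0∞) ^ (n : ℕ)) * v :=
        tsum_rate_mul_le fun n hn => zpow_le_of_abs_add_le hz (by
          have hle : ((n : ℕ) : ℤ) ≤ q.1 i := by
            by_contra hlt
            exact hn ((h_sign q i n).1 (bestAsk_le_of_pos hpos') (not_le.1 hlt))
          rw [abs_of_nonneg (by omega), abs_of_pos hpos']
          omega)
      have hd := sizeGen_drift hfs hgs hb.one_lt hF (hb.Gf_ne_top i q) hb.δ_pos
        (hb.ask_size q i hpos) (hb.ask_drift q i hpos)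
      calc _ ≤ _ := add_le_add (add_le_add hf hg) le_rfl
        _ = ((∑' n : ℕ+, (M.f i q n : ℝ≥0∞) * (z : ℝ≥0∞) ^ (n : ℕ)) +
            (∑' n : ℕ+, (M.g i q n : ℝ≥0∞) * ((z⁻¹ : ℝ≥0) : ℝ≥0∞) ^ (n : ℕ)) +
            M.flow q * (r * δ)) * v := by ring
        _ ≤ (M.fStar i q + M.gStar i q) * v := mul_le_mul_left hd _
        _ ≤ _ := le_self_add
    · have hneg' : q.1 i < 0 := by exact_mod_cast (by linarith : (q.1 i : ℝ) < 0)
      have hlt : (q.1 i : ℝ) < -U := by linarith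
      have hg : ∑' n : ℕ+, (M.g i q n : ℝ≥0∞) * zpow U z (q.1 i - (n : ℕ)) ≤
          (∑' n : ℕ+, (M.g i q n : ℝ≥0∞) * (z : ℝ≥0∞) ^ (n : ℕ)) * v :=
        tsum_rate_mul_le fun n _ => zpow_le_of_abs_le hz (by
          refine (abs_sub _ _).trans (le_of_eq ?_); simp)
      have hf : ∑' n : ℕ+, (M.f i q n : ℝ≥0∞) * zpow U z (q.1 i + (n : ℕ)) ≤
          (∑' n : ℕ+, (M.f i q n : ℝ≥0∞) * ((z⁻¹ : ℝ≥0) : ℝ≥0∞) ^ (n : ℕ)) * v :=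
        tsum_rate_mul_le fun n hn => zpow_le_of_abs_add_le hz (by
          have hle : ((n : ℕ) : ℤ) ≤ -q.1 i := by
            by_contra hlt
            exact hn ((h_sign q i n).2 (le_bestBid_of_neg hneg') (not_le.1 hlt))
          rw [abs_of_nonpos (by omega), abs_of_neg hneg']
          omega)
      have hd := sizeGen_drift hgs hfs hb.one_lt hF (hb.Gg_ne_top i q) hb.δ_pos
        (hb.bid_size q i hlt) (hb.bid_drift q i hlt)
      calc _ ≤ _ := add_le_add (add_le_add hf hg) le_rfl
        _ = ((∑' n : ℕ+, (M.g i q n : ℝ≥0∞) * (z : ℝ≥0∞) ^ (n : ℕ)) +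
            (∑' n : ℕ+, (M.f i q n : ℝ≥0∞) * ((z⁻¹ : ℝ≥0) : ℝ≥0∞) ^ (n : ℕ)) +
            M.flow q * (r * δ)) * v := by ring
        _ ≤ (M.gStar i q + M.fStar i q) * v := mul_le_mul_left hd _
        _ = (M.fStar i q + M.gStar i q) * v := by rw [add_comm (M.gStar i q : ℝ≥0∞)]
        _ ≤ _ := le_self_add
  · have hv1 : v ≤ 1 := zpow_le_one hz hsmall
    -- Upward jumps either lower the weight, when `i` is on the bid side, or are insertions. Likewise
    -- for downward jumps and the ask side.
    have hf : ∑' n : ℕ+, (M.f i q n : ℝ≥0∞) * zpow U z (q.1 i + (n : ℕ)) ≤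
        M.fStar i q * v + M.flow q * L := by
      rcases lt_or_ge (bestBid q.1) (i : WithBot (Fin (2 * K))) with hi | hi
      · refine le_trans ?_ le_add_self
        have h1 : ∑' n : ℕ+, (M.f i q n : ℝ≥0∞) * zpow U z (q.1 i + (n : ℕ)) ≤
            (∑' n : ℕ+, (M.f i q n : ℝ≥0∞) * (z : ℝ≥0∞) ^ (n : ℕ)) * v :=
          tsum_rate_mul_le fun n _ => zpow_le_of_abs_le hz (by
            refine (abs_add_le _ _).trans (le_of_eq ?_); simp)
        have h2 : (M.fStar i q : ℝ≥0∞) = M.flow q * M.aStar i q := by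
          rw [aStar, ← ENNReal.coe_mul, mul_div_cancel₀ _ hF.ne']
        rw [← tsum_mul_sizeGen hfs] at h1
        calc _ ≤ _ := h1
          _ ≤ (M.fStar i q : ℝ≥0∞) * M.Gf i q z * 1 :=
            mul_le_mul_right (by exact_mod_cast hv1) _
          _ = M.flow q * (M.aStar i q * M.Gf i q z) := by rw [h2, mul_one, mul_assoc]
          _ ≤ _ := mul_le_mul_right (hb.ask_insert q i hi) _
      · refine le_trans ?_ le_self_add
        rw [M.coe_fStar hM, ← ENNReal.tsum_mul_right]
        refine ENNReal.tsum_le_tsum fun n => ?_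
        by_cases hn : M.f i q n = 0
        · simp [hn]
        · refine mul_le_mul_right (ENNReal.coe_le_coe.2 ?_) _
          have hle : ((n : ℕ) : ℤ) ≤ -q.1 i := by
            by_contra hlt
            exact hn ((h_sign q i n).2 hi (not_le.1 hlt))
          refine (zpow_le_of_abs_le (n := 0) hz ?_).trans (by rw [pow_zero, one_mul])
          rw [abs_of_nonpos (by omega), abs_of_nonpos (by omega)]
          push_cast
          omega
    have hg : ∑' n : ℕ+, (M.g i q n : ℝ≥0∞) * zpow U z (q.1 i - (n : ℕ)) ≤
        M.gStar i q * v + M.flow q * L := by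
      rcases lt_or_ge (i : WithTop (Fin (2 * K))) (bestAsk q.1) with hi | hi
      · refine le_trans ?_ le_add_self
        have h1 : ∑' n : ℕ+, (M.g i q n : ℝ≥0∞) * zpow U z (q.1 i - (n : ℕ)) ≤
            (∑' n : ℕ+, (M.g i q n : ℝ≥0∞) * (z : ℝ≥0∞) ^ (n : ℕ)) * v :=
          tsum_rate_mul_le fun n _ => zpow_le_of_abs_le hz (by
            refine (abs_sub _ _).trans (le_of_eq ?_); simp)
        have h2 : (M.gStar i q : ℝ≥0∞) = M.flow q * M.bStar i q := by
          rw [bStar, ← ENNReal.coe_mul, mul_div_cancel₀ _ hF.ne']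
        rw [← tsum_mul_sizeGen hgs] at h1
        calc _ ≤ _ := h1
          _ ≤ (M.gStar i q : ℝ≥0∞) * M.Gg i q z * 1 :=
            mul_le_mul_right (by exact_mod_cast hv1) _
          _ = M.flow q * (M.bStar i q * M.Gg i q z) := by rw [h2, mul_one, mul_assoc]
          _ ≤ _ := mul_le_mul_right (hb.bid_insert q i hi) _
      · refine le_trans ?_ le_self_add
        rw [M.coe_gStar hM, ← ENNReal.tsum_mul_right]
        refine ENNReal.tsum_le_tsum fun n => ?_
        by_cases hn : M.g i q n = 0
        · simp [hn]
        · refine mul_le_mul_right (ENNReal.coe_le_coe.2 ?_) _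
          have hle : ((n : ℕ) : ℤ) ≤ q.1 i := by
            by_contra hlt
            exact hn ((h_sign q i n).1 hi (not_le.1 hlt))
          refine (zpow_le_of_abs_le (n := 0) hz ?_).trans (by rw [pow_zero, one_mul])
          rw [abs_of_nonneg (by omega), abs_of_nonneg (by omega)]
          push_cast
          omega
    calc _ ≤ ((M.fStar i q : ℝ≥0∞) * v + M.flow q * L) + (M.gStar i q * v + M.flow q * L) +
          M.flow q * (r * δ * 1) := by
          refine add_le_add (add_le_add hf hg) ?_
          exact mul_le_mul_right (mul_le_mul_right (by exact_mod_cast hv1) _) _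
      _ = _ := by ring

end OrderBook

/-! ### Drift of the order book -/

/-- A shift to the left that lets `l` in adds at most the weight of `l`. -/
theorem sum_fin_shift_left_le {n : ℕ} (φ : ℤ → ℝ≥0) (q : Fin n → ℤ) (l : ℤ) :
    ∑ i : Fin n, φ (if h : (i : ℕ) + 1 < n then q ⟨(i : ℕ) + 1, h⟩ else l) ≤
      (∑ i, φ (q i)) + φ l := by
  cases n with
  | zero => simp
  | succ n =>
    rw [Fin.sum_univ_castSucc, Fin.sum_univ_succ (fun i => φ (q i))]
    have h1 : ∀ i : Fin n, φ (if h : ((Fin.castSucc i : Fin (n + 1)) : ℕ) + 1 < n + 1 then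
        q ⟨((Fin.castSucc i : Fin (n + 1)) : ℕ) + 1, h⟩ else l) = φ (q i.succ) := fun i => by
      rw [dif_pos (by simp)]
      rfl
    simp only [h1]
    simp only [Fin.val_last, lt_irrefl, dite_false]
    gcongr
    exact le_add_self

/-- A shift to the right that lets `l` in adds at most the weight of `l`. -/
theorem sum_fin_shift_right_le {n : ℕ} (φ : ℤ → ℝ≥0) (q : Fin n → ℤ) (l : ℤ) :
    ∑ i : Fin n, φ (if (i : ℕ) = 0 then l
      else q ⟨(i : ℕ) - 1, lt_of_le_of_lt (Nat.sub_le _ _) i.2⟩) ≤ (∑ i, φ (q i)) + φ l := by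
  cases n with
  | zero => simp
  | succ n =>
    rw [Fin.sum_univ_succ, Fin.sum_univ_castSucc (fun i => φ (q i))]
    simp only [Fin.val_zero, if_true, Fin.val_succ, Nat.succ_ne_zero, if_false,
      Nat.add_sub_cancel]
    rw [add_comm]
    gcongr
    refine le_trans (le_of_eq ?_) le_self_add
    exact Finset.sum_congr rfl fun i _ => rfl

namespace OrderBook

variable {K : ℕ} {M : OrderBook K}

/-- The weight `∑ i, z ^ (|t i| - U)` of a vector that need not be a book. -/
noncomputable def vecWeight (U : ℝ) (z : ℝ≥0) (t : Fin (2 * K) → ℤ) : ℝ≥0 := ∑ i, zpow U z (t i)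

theorem pure_drift (hM : M.Standing) (h_sign : M.NoSignReversal) {U : ℝ} (hU : 1 < U)
    {z r δ L : ℝ≥0} (hb : M.QueueBounds U z r δ L) (q : Book K) :
    ∑' q', M.pureRate q q' * (Vz U z q' : ℝ≥0∞) + M.flow q * (r * δ * Vz U z q) ≤
      M.flow q * Vz U z q + M.flow q * ((2 * K : ℕ) * (2 * L + r * δ)) := by
  have hVz : ∀ q' : Book K, (Vz U z q' : ℝ≥0∞) = (vecWeight U z q'.1 : ℝ≥0∞) := fun _ => rfl
  simp_rw [hVz]
  rw [tsum_pureRate_mul hM (fun t => (vecWeight U z t : ℝ≥0∞))]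
  let rest : Fin (2 * K) → ℝ≥0 := fun i => ∑ j ∈ Finset.univ.erase i, zpow U z (q.1 j)
  have hsplit : ∀ i (m : ℤ), vecWeight U z (q.1 + Pi.single i m) =
      zpow U z (q.1 i + m) + rest i := fun i m => by
    rw [vecWeight, ← Finset.add_sum_erase _ _ (Finset.mem_univ i)]
    congr 1
    · simp
    · refine Finset.sum_congr rfl fun j hj => ?_
      simp [Finset.ne_of_mem_erase hj]
  have hsplit' : ∀ i (m : ℤ), vecWeight U z (q.1 - Pi.single i m) =
      zpow U z (q.1 i - m) + rest i := fun i m => by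
    rw [sub_eq_add_neg, ← Pi.single_neg, hsplit, sub_eq_add_neg]
  have hself : ∀ i, vecWeight U z q.1 = zpow U z (q.1 i) + rest i := fun i => by
    simpa using hsplit i 0
  have hf : ∀ i, ∑' n : ℕ+, (M.f i q n : ℝ≥0∞) *
      (vecWeight U z (q.1 + Pi.single i ((n : ℕ) : ℤ)) : ℝ≥0∞) =
      (∑' n : ℕ+, (M.f i q n : ℝ≥0∞) * zpow U z (q.1 i + (n : ℕ))) + M.fStar i q * rest i := by
    intro i
    simp_rw [hsplit, ENNReal.coe_add, mul_add]
    rw [ENNReal.tsum_add, ENNReal.tsum_mul_right, M.coe_fStar hM]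
  have hg : ∀ i, ∑' n : ℕ+, (M.g i q n : ℝ≥0∞) *
      (vecWeight U z (q.1 - Pi.single i ((n : ℕ) : ℤ)) : ℝ≥0∞) =
      (∑' n : ℕ+, (M.g i q n : ℝ≥0∞) * zpow U z (q.1 i - (n : ℕ))) + M.gStar i q * rest i := by
    intro i
    simp_rw [hsplit', ENNReal.coe_add, mul_add]
    rw [ENNReal.tsum_add, ENNReal.tsum_mul_right, M.coe_gStar hM]
  have hflow : (M.flow q : ℝ≥0∞) * vecWeight U z q.1 =
      ∑ i, ((M.fStar i q + M.gStar i q) * zpow U z (q.1 i) +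
        (M.fStar i q + M.gStar i q) * rest i : ℝ≥0∞) := by
    rw [flow, ENNReal.ofNNReal_finsetSum, Finset.sum_mul]
    refine Finset.sum_congr rfl fun i _ => ?_
    rw [hself i]
    push_cast
    ring
  have hdamp : (M.flow q : ℝ≥0∞) * (r * δ * vecWeight U z q.1) =
      ∑ i, (M.flow q : ℝ≥0∞) * (r * δ * zpow U z (q.1 i)) := by
    rw [vecWeight, ENNReal.ofNNReal_finsetSum, Finset.mul_sum, Finset.mul_sum]
  have hconst : (M.flow q : ℝ≥0∞) * ((2 * K : ℕ) * (2 * L + r * δ)) =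
      ∑ _i : Fin (2 * K), (M.flow q : ℝ≥0∞) * (2 * L + r * δ) := by
    rw [Finset.sum_const, Finset.card_univ, Fintype.card_fin, nsmul_eq_mul]
    ring
  rw [hdamp, hflow, hconst, ← Finset.sum_add_distrib, ← Finset.sum_add_distrib]
  refine Finset.sum_le_sum fun i _ => ?_
  rw [hf, hg]
  calc _ = ((∑' n : ℕ+, (M.f i q n : ℝ≥0∞) * zpow U z (q.1 i + (n : ℕ))) +
      (∑' n : ℕ+, (M.g i q n : ℝ≥0∞) * zpow U z (q.1 i - (n : ℕ))) +
      M.flow q * (r * δ * zpow U z (q.1 i))) +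
      (M.fStar i q + M.gStar i q) * rest i := by ring
    _ ≤ _ := add_le_add (queue_drift hM h_sign hU hb q i) le_rfl
    _ = _ := by ring

open Classical in
/-- Price jumps: the shifted books gain at most the entering queue, the reinitialized ones have
bounded mean weight. -/
theorem shift_drift {θ : ℝ≥0} (hθ : θ ≤ 1) {U : ℝ} {z B : ℝ≥0} {q : Book K} (u : ℝ≥0) {ν : PMF ℤ}
    {μ : PMF (Book K)} {t : ℤ → Fin (2 * K) → ℤ}
    (ht : ∀ l, vecWeight U z (t l) ≤ Vz U z q + zpow U z l)
    (hν : ∑' l, ν l * (zpow U z l : ℝ≥0∞) ≤ B) (hμ : ∑' q', μ q' * (Vz U z q' : ℝ≥0∞) ≤ B) :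
    ∑' q' : Book K, (((1 - θ : ℝ≥0) : ℝ≥0∞) * u * (∑' l : ℤ, if q'.1 = t l then ν l else 0)
      + (θ : ℝ≥0∞) * u * μ q') * (Vz U z q' : ℝ≥0∞) ≤ u * (Vz U z q + B) := by
  have h1 : ∑' q' : Book K, (∑' l : ℤ, if q'.1 = t l then ν l else 0) * (Vz U z q' : ℝ≥0∞) ≤
      Vz U z q + B := by
    simp_rw [← ENNReal.tsum_mul_right]
    rw [ENNReal.tsum_comm]
    calc ∑' l, ∑' q' : Book K, (if q'.1 = t l then ν l else 0) * (Vz U z q' : ℝ≥0∞)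
        ≤ ∑' l, ν l * ((Vz U z q : ℝ≥0∞) + zpow U z l) := by
          refine ENNReal.tsum_le_tsum fun l => ?_
          refine (tsum_book_ite_mul_le (ν l) (t l) fun s => (vecWeight U z s : ℝ≥0∞)).trans ?_
          exact mul_le_mul_right (by exact_mod_cast ht l) _
      _ ≤ _ := by
          simp_rw [mul_add]
          rw [ENNReal.tsum_add, ENNReal.tsum_mul_right, PMF.tsum_coe, one_mul]
          gcongr
  have hθ1 : ((1 - θ : ℝ≥0) : ℝ≥0∞) + θ = 1 := by
    rw [← ENNReal.coe_add, tsub_add_cancel_of_le hθ, ENNReal.coe_one]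
  simp_rw [add_mul, mul_assoc]
  rw [ENNReal.tsum_add, ENNReal.tsum_mul_left, ENNReal.tsum_mul_left, ENNReal.tsum_mul_left,
    ENNReal.tsum_mul_left]
  calc _ ≤ ((1 - θ : ℝ≥0) : ℝ≥0∞) * (u * (Vz U z q + B)) + θ * (u * (Vz U z q + B)) := by
        refine add_le_add ?_ ?_
        · exact mul_le_mul_right (mul_le_mul_right h1 _) _
        · exact mul_le_mul_right (mul_le_mul_right (hμ.trans le_add_self) _) _
    _ = (((1 - θ : ℝ≥0) : ℝ≥0∞) + θ) * (u * (Vz U z q + B)) := by rw [add_mul]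
    _ = u * (Vz U z q + B) := by rw [hθ1, one_mul]

/-- Bounds on the mean weights of the laws that enter at price jumps. -/
structure BoundaryBounds (M : OrderBook K) (U : ℝ) (z B : ℝ≥0) : Prop where
  inc : ∑' q, M.πinc q * (Vz U z q : ℝ≥0∞) ≤ B
  dec : ∑' q, M.πdec q * (Vz U z q : ℝ≥0∞) ≤ B
  top : ∑' l, M.πK l * (zpow U z l : ℝ≥0∞) ≤ B
  bot : ∑' l, M.πmK l * (zpow U z l : ℝ≥0∞) ≤ B

theorem up_drift (hM : M.Standing) {U : ℝ} {z B : ℝ≥0} (hB : M.BoundaryBounds U z B)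
    (q : Book K) :
    ∑' q', M.upRate q q' * (Vz U z q' : ℝ≥0∞) ≤ M.u q * (Vz U z q + B) := by
  have h := shift_drift hM.θ_le_one (q := q) (M.u q) (t := fun l => shiftUp q.1 l)
    (fun l => sum_fin_shift_left_le (zpow U z) q.1 l) hB.top hB.inc
  exact h

theorem down_drift (hM : M.Standing) {U : ℝ} {z B : ℝ≥0} (hB : M.BoundaryBounds U z B)
    (q : Book K) :
    ∑' q', M.downRate q q' * (Vz U z q' : ℝ≥0∞) ≤ M.d q * (Vz U z q + B) := by
  have h := shift_drift hM.θ_le_one (q := q) (M.d q) (t := fun l => shiftDown l q.1)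
    (fun l => sum_fin_shift_right_le (zpow U z) q.1 l) hB.bot hB.dec
  exact h

end OrderBook

/-! ### Choice of the base of the weight -/

namespace OrderBook

variable {K : ℕ} {M : OrderBook K}

theorem Gf_mono (i : Fin (2 * K)) (q : Book K) : Monotone (M.Gf i q) := fun z z' h =>
  ENNReal.tsum_le_tsum fun n => ENNReal.coe_le_coe.2 (by gcongr)

theorem Gg_mono (i : Fin (2 * K)) (q : Book K) : Monotone (M.Gg i q) := fun z z' h =>
  ENNReal.tsum_le_tsum fun n => ENNReal.coe_le_coe.2 (by gcongr)

theorem le_toReal_sub_one {x : ℝ≥0∞} (hx : x ≠ ∞) {δ : ℝ} (h : (δ : EReal) ≤ (x : EReal) - 1) :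
    δ ≤ x.toReal - 1 := by
  rw [← EReal.coe_ennreal_toReal hx] at h
  exact_mod_cast h

theorem exists_queueBounds (h_mom : M.ExpMoments) (h_ins : M.InsertionBound M.aStar M.bStar)
    {r U : ℝ} (hr : 0 < r) (hU : 1 < U) (h_size : M.SizeBound U) (h_drift : M.NegativeDrift r U)
    {z₀ : ℝ≥0} (hz₀ : 1 < z₀) :
    ∃ z δ L : ℝ≥0, z ≤ z₀ ∧ M.QueueBounds U z r.toNNReal δ L := by
  obtain ⟨zs, hzs, hfin⟩ := h_mom
  obtain ⟨L, hL, hins⟩ := h_ins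
  have e1 := eventually_lt_of_limsup_lt h_drift.1
  have e2 := eventually_lt_of_limsup_lt h_drift.2
  have e3 := eventually_all.2 fun i => eventually_lt_of_limsup_lt (hins i)
  have e4 : ∀ᶠ z in 𝓝[>] (1 : ℝ≥0), z < min z₀ zs :=
    nhdsWithin_le_nhds (eventually_lt_nhds (lt_min hz₀ hzs))
  obtain ⟨z, ⟨⟨⟨⟨h1, h2⟩, h3⟩, h4⟩, hz⟩⟩ :=
    ((((e1.and e2).and e3).and e4).and (eventually_mem_nhdsWithin)).exists
  have hz : 1 < z := hz
  obtain ⟨hs1, hs2⟩ := h_size z hz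
  obtain ⟨δ, hδ0, hδ⟩ := EReal.lt_iff_exists_real_btwn.1 (lt_min hs1 hs2)
  have hδ0 : 0 < δ := by exact_mod_cast hδ0
  have hGf : ∀ i q, M.Gf i q z ≠ ∞ := fun i q =>
    ((Gf_mono i q (h4.le.trans (min_le_right _ _))).trans_lt (hfin i q).1).ne
  have hGg : ∀ i q, M.Gg i q z ≠ ∞ := fun i q =>
    ((Gg_mono i q (h4.le.trans (min_le_right _ _))).trans_lt (hfin i q).2).ne
  have hask : ∀ (q : Book K) (i : Fin (2 * K)), U < q.1 i → bestAsk q.1 ≤ i :=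
    fun q i h => bestAsk_le_of_pos (by exact_mod_cast (by linarith : (0 : ℝ) < q.1 i))
  have hbid : ∀ (q : Book K) (i : Fin (2 * K)), (q.1 i : ℝ) < -U →
      (i : WithBot (Fin (2 * K))) ≤ bestBid q.1 :=
    fun q i h => le_bestBid_of_neg (by exact_mod_cast (by linarith : (q.1 i : ℝ) < 0))
  lift δ to ℝ≥0 using hδ0.le
  refine ⟨z, δ, L, h4.le.trans (min_le_left _ _), ?_⟩
  exact
    { one_lt := hz
      δ_pos := by exact_mod_cast hδ0
      Gf_ne_top := hGf
      Gg_ne_top := hGg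
      ask_size := fun q i h => le_toReal_sub_one (hGf i q) <|
        (hδ.le.trans (min_le_left _ _)).trans
          (iInf_le_of_le q (iInf_le_of_le i (iInf₂_le_of_le h (hask q i h) le_rfl)))
      bid_size := fun q i h => le_toReal_sub_one (hGg i q) <|
        (hδ.le.trans (min_le_right _ _)).trans
          (iInf_le_of_le q (iInf_le_of_le i (iInf₂_le_of_le h (hbid q i h) le_rfl)))
      ask_drift := fun q i h => by
        rw [Real.coe_toNNReal r hr.le, ← EReal.coe_le_coe_iff]
        refine le_trans ?_ h1.le
        exact le_iSup_of_le q (le_iSup_of_le i (le_iSup₂_of_le h (hask q i h) le_rfl))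
      bid_drift := fun q i h => by
        rw [Real.coe_toNNReal r hr.le, ← EReal.coe_le_coe_iff]
        refine le_trans ?_ h2.le
        exact le_iSup_of_le q (le_iSup_of_le i (le_iSup₂_of_le h (hbid q i h) le_rfl))
      ask_insert := fun q i h => by
        refine le_trans ?_ (h3 i).le
        refine le_trans ?_ (le_iSup _ q)
        rw [if_pos h]
        exact le_self_add
      bid_insert := fun q i h => by
        refine le_trans ?_ (h3 i).le
        refine le_trans ?_ (le_iSup _ q)
        rw [if_pos h]
        exact le_add_self }

theorem zpow_le_zpow_add_one {U : ℝ} {z z₀ : ℝ≥0} (hz : 1 ≤ z) (hzz : z ≤ z₀) (m : ℤ) :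
    zpow U z m ≤ zpow U z₀ m + 1 := by
  rcases le_total |(m : ℝ)| U with h | h
  · exact (zpow_le_one hz h).trans le_add_self
  · exact (NNReal.rpow_le_rpow hzz (sub_nonneg.2 h)).trans le_self_add

theorem exists_boundaryBounds {U : ℝ} (h_bdry : M.BoundaryMoments U) :
    ∃ z₀ B : ℝ≥0, 1 < z₀ ∧ ∀ z, 1 ≤ z → z ≤ z₀ → M.BoundaryBounds U z B := by
  obtain ⟨z₀, Lp, hz₀, -, hLp⟩ := h_bdry
  refine ⟨z₀, Lp + (2 * K : ℕ) + 1, hz₀, fun z hz hzz => ?_⟩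
  have hVz : ∀ q : Book K, Vz U z q ≤ Vz U z₀ q + (2 * K : ℕ) := fun q => by
    calc Vz U z q ≤ ∑ i, (zpow U z₀ (q.1 i) + 1) :=
          Finset.sum_le_sum fun i _ => zpow_le_zpow_add_one hz hzz _
      _ = _ := by
          rw [Finset.sum_add_distrib, Finset.sum_const, Finset.card_univ, Fintype.card_fin,
            nsmul_eq_mul, mul_one]
          rfl
  have hmean : ∀ {T : Type} (μ : PMF T) (a a₀ : T → ℝ≥0) (c : ℝ≥0), (∀ t, a t ≤ a₀ t + c) →
      ∑' t, μ t * (a₀ t : ℝ≥0∞) ≤ Lp → c ≤ (2 * K : ℕ) + 1 →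
      ∑' t, μ t * (a t : ℝ≥0∞) ≤ ((Lp + (2 * K : ℕ) + 1 : ℝ≥0) : ℝ≥0∞) :=
    fun μ a a₀ c ha h hc => by
      calc ∑' t, μ t * (a t : ℝ≥0∞) ≤ ∑' t, μ t * ((a₀ t : ℝ≥0∞) + c) :=
            ENNReal.tsum_le_tsum fun t => mul_le_mul_right (by exact_mod_cast ha t) _
        _ = (∑' t, μ t * (a₀ t : ℝ≥0∞)) + c := by
            simp_rw [mul_add]
            rw [ENNReal.tsum_add, ENNReal.tsum_mul_right, PMF.tsum_coe, one_mul]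
        _ ≤ Lp + ((2 * K : ℕ) + 1 : ℝ≥0) := by gcongr
        _ = _ := by push_cast; ring
  exact
    { inc := hmean _ _ _ _ hVz
        ((le_self_add.trans (le_self_add.trans le_self_add)).trans hLp) le_self_add
      dec := hmean _ _ _ _ hVz
        ((le_add_self.trans (le_self_add.trans le_self_add)).trans hLp) le_self_add
      top := hmean _ _ _ _ (zpow_le_zpow_add_one hz hzz)
        ((le_add_self.trans le_self_add).trans hLp) le_add_self
      bot := hmean _ _ _ _ (zpow_le_zpow_add_one hz hzz) (le_add_self.trans hLp) le_add_self }

/-! ### Geometric drift of the chain -/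

/-- Drift before normalization by the total jump rate. -/
theorem generator_drift (hM : M.Standing) (h_sign : M.NoSignReversal) {U : ℝ} (hU : 1 < U)
    {z r δ L B : ℝ≥0} (hb : M.QueueBounds U z r δ L) (hB : M.BoundaryBounds U z B) (q : Book K) :
    ∑' q', (M.pureRate q q' + M.upRate q q' + M.downRate q q') * (Vz U z q' : ℝ≥0∞) +
        M.flow q * (r * δ * Vz U z q) ≤
      ((M.flow q + M.u q + M.d q : ℝ≥0) : ℝ≥0∞) *
        (Vz U z q + ((2 * K : ℕ) * (2 * L + r * δ) + B)) := by
  simp_rw [add_mul]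
  rw [ENNReal.tsum_add, ENNReal.tsum_add]
  have h1 := pure_drift hM h_sign hU hb q
  have h2 := up_drift hM hB q
  have h3 := down_drift hM hB q
  calc _ = (∑' q', M.pureRate q q' * (Vz U z q' : ℝ≥0∞) + M.flow q * (r * δ * Vz U z q)) +
        ∑' q', M.upRate q q' * (Vz U z q' : ℝ≥0∞) +
        ∑' q', M.downRate q q' * (Vz U z q' : ℝ≥0∞) := by ring
    _ ≤ _ := add_le_add (add_le_add h1 h2) h3
    _ ≤ (M.flow q * Vz U z q + M.flow q * ((2 * K : ℕ) * (2 * L + r * δ)) + M.flow q * B) +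
        (M.u q * (Vz U z q + B) + M.u q * ((2 * K : ℕ) * (2 * L + r * δ))) +
        (M.d q * (Vz U z q + B) + M.d q * ((2 * K : ℕ) * (2 * L + r * δ))) :=
      add_le_add (add_le_add le_self_add le_self_add) le_self_add
    _ = _ := by push_cast; ring

/-- Geometric drift of the weight `1 + V` along the chain `Ychain`. Outside a finite set of shapes
the order flow carries a fixed proportion of the total jump rate. -/
theorem exists_geometric_drift (hM : M.Standing) (h_sign : M.NoSignReversal) {U : ℝ} (hU : 1 < U)
    {z r δ L B : ℝ≥0} (hr : 0 < r) (hb : M.QueueBounds U z r δ L) (hB : M.BoundaryBounds U z B)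
    (h_jump : M.PriceJumpBound) :
    ∃ lam b : ℝ≥0, lam < 1 ∧ ∀ x : M.YState,
      ∑' y : M.YState, M.Ychain x y * ((1 + Vz U z y.1 : ℝ≥0) : ℝ≥0∞) ≤
        lam * ((1 + Vz U z x.1 : ℝ≥0) : ℝ≥0∞) + b := by
  obtain ⟨W, hW, hs⟩ := h_jump
  obtain ⟨s, hs1, hs⟩ : ∃ s : ℝ≥0, s < 1 ∧ ∀ q ∉ W,
      (M.u q + M.d q) / (M.flow q + M.u q + M.d q) ≤ s := by
    obtain ⟨s, hs0, hs1⟩ := ENNReal.lt_iff_exists_nnreal_btwn.1 hs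
    refine ⟨s, by exact_mod_cast hs1, fun q hq => ?_⟩
    have := (le_iSup (fun q : {q : Book K // q ∉ W} =>
      (((M.u q + M.d q) / (M.flow q + M.u q + M.d q) : ℝ≥0) : ℝ≥0∞)) ⟨q, hq⟩).trans hs0.le
    exact_mod_cast this
  obtain ⟨m, hm⟩ : ∃ m : ℝ≥0, ∀ q ∈ W, Vz U z q ≤ m :=
    ⟨hW.toFinset.sup (Vz U z), fun q hq => Finset.le_sup (hW.mem_toFinset.2 hq)⟩
  have hδ := hb.δ_pos
  set C : ℝ≥0 := (2 * K : ℕ) * (2 * L + r * δ) + B with hC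
  have hs1' : (s : ℝ) < 1 := by exact_mod_cast hs1
  obtain ⟨κ, hκ0, hκ1, hκ⟩ : ∃ κ : ℝ, 0 < κ ∧ κ ≤ 1 ∧ κ ≤ (1 - s) * (r * δ) := by
    have hpos : 0 < (1 - (s : ℝ)) * (r * δ) := mul_pos (by linarith) (by positivity)
    exact ⟨min 1 ((1 - s) * (r * δ)), lt_min one_pos hpos, min_le_left _ _, min_le_right _ _⟩
  obtain ⟨lam, hlam⟩ : ∃ lam : ℝ≥0, (lam : ℝ) = 1 - κ :=
    ⟨⟨1 - κ, by linarith⟩, rfl⟩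
  refine ⟨lam, C + m + 1, by exact_mod_cast (by linarith : (lam : ℝ) < 1), fun x => ?_⟩
  set q := x.1 with hq
  set E : ℝ≥0 := M.flow q + M.u q + M.d q with hE
  have hE0 : 0 < E := by
    have := hM.flow_pos q
    positivity
  have hgen := generator_drift hM h_sign hU hb hB q
  rw [tsum_Ychain_mul hM x (fun q' => ((1 + Vz U z q' : ℝ≥0) : ℝ≥0∞)), ← hq, ← hE]
  have hone : ∑' q', (M.pureRate q q' + M.upRate q q' + M.downRate q q') *
      ((1 + Vz U z q' : ℝ≥0) : ℝ≥0∞) = E + ∑' q',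
      (M.pureRate q q' + M.upRate q q' + M.downRate q q') * (Vz U z q' : ℝ≥0∞) := by
    simp_rw [ENNReal.coe_add, mul_add, ENNReal.coe_one, mul_one]
    rw [ENNReal.tsum_add, ENNReal.tsum_add, ENNReal.tsum_add, tsum_pureRate hM, hM.up_total,
      hM.down_total, hE]
    push_cast
    rfl
  rw [hone]
  generalize (∑' q', (M.pureRate q q' + M.upRate q q' + M.downRate q q') *
    (Vz U z q' : ℝ≥0∞)) = N at hgen ⊢
  have hN : N ≠ ∞ := by
    refine ne_top_of_le_ne_top ?_ (le_self_add.trans hgen)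
    rw [← ENNReal.coe_natCast, ← ENNReal.coe_ofNat]
    norm_cast
    exact ENNReal.coe_ne_top
  lift N to ℝ≥0 using hN
  have hgen' : (N : ℝ) + M.flow q * (r * δ * Vz U z q) ≤ E * (Vz U z q + C) := by
    rw [hC]
    exact_mod_cast hgen
  rw [← div_eq_mul_inv, ENNReal.div_le_iff (by exact_mod_cast hE0.ne') ENNReal.coe_ne_top]
  suffices h : (E : ℝ) + N ≤ (lam * (1 + Vz U z q) + (C + m + 1)) * E by exact_mod_cast h
  have hE0' : (0 : ℝ) < E := by exact_mod_cast hE0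
  have hV0 : (0 : ℝ) ≤ Vz U z q := (Vz U z q).coe_nonneg
  have hm0 : (0 : ℝ) ≤ m := m.coe_nonneg
  have hkey : (N : ℝ) ≤ E * ((1 - κ) * Vz U z q + C + m) := by
    by_cases hqW : q ∈ W
    · have h1 : (Vz U z q : ℝ) ≤ m := by exact_mod_cast hm q hqW
      have h2 : 0 ≤ (M.flow q : ℝ) * (r * δ * Vz U z q) := by positivity
      have h3 : (Vz U z q : ℝ) + C ≤ (1 - κ) * Vz U z q + C + m := by nlinarith
      have h4 := mul_le_mul_of_nonneg_left h3 hE0'.le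
      linarith
    · have h1 : ((M.u q : ℝ) + M.d q) ≤ s * E := by
        have h := hs q hqW
        rw [← hE, div_le_iff₀ hE0] at h
        exact_mod_cast h
      have h2 : (1 - (s : ℝ)) * E ≤ M.flow q := by
        have : (E : ℝ) = M.flow q + M.u q + M.d q := by rw [hE]; push_cast; ring
        linarith
      have h3 : κ * E * Vz U z q ≤ M.flow q * (r * δ * Vz U z q) := by
        have a1 := mul_le_mul_of_nonneg_right hκ hE0'.le
        have a2 := mul_le_mul_of_nonneg_left h2 (by positivity : (0 : ℝ) ≤ r * δ)
        have a3 := mul_le_mul_of_nonneg_right (a1.trans (by linarith : (1 - (s : ℝ)) * (r * δ) * E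
          ≤ M.flow q * (r * δ))) hV0
        linarith
      have h4 : 0 ≤ (E : ℝ) * m := by positivity
      linarith
  rw [hlam]
  have h5 : 0 ≤ (1 - κ) * (E : ℝ) := mul_nonneg (by linarith) hE0'.le
  linarith

theorem finite_Vz_le {U : ℝ} {z : ℝ≥0} (hz : 1 < z) (c : ℝ≥0) :
    {q : Book K | Vz U z q ≤ c}.Finite := by
  obtain ⟨n, hn⟩ := pow_unbounded_of_one_lt c hz
  obtain ⟨m, hm⟩ := exists_nat_ge (n + U)
  have hinj : Set.InjOn (fun q : Book K => q.1)
      (Subtype.val ⁻¹' Set.Icc (fun _ => -(m : ℤ)) fun _ => m) := fun _ _ _ _ h => Subtype.ext h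
  refine (Set.Finite.preimage hinj
    (Set.finite_Icc (fun _ : Fin (2 * K) => -(m : ℤ)) fun _ => (m : ℤ))).subset fun q hq => ?_
  have habs : ∀ i, |q.1 i| ≤ m := fun i => by
    by_contra hlt
    have h1 : (m : ℝ) < |(q.1 i : ℝ)| := by exact_mod_cast not_le.1 hlt
    have h2 : z ^ n ≤ zpow U z (q.1 i) := by
      rw [← NNReal.rpow_natCast]
      exact NNReal.rpow_le_rpow_of_exponent_le hz.le (by linarith)
    have h3 : zpow U z (q.1 i) ≤ Vz U z q :=
      Finset.single_le_sum (f := fun i => zpow U z (q.1 i)) (fun _ _ => zero_le)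
        (Finset.mem_univ i)
    exact absurd (hn.trans_le (h2.trans h3)) (not_lt.2 hq)
  exact ⟨fun i => (abs_le.1 (habs i)).1, fun i => (abs_le.1 (habs i)).2⟩

instance : Countable (Book K) := Subtype.countable

instance (α : ℝ) : Finite (Increment α) :=
  Set.Finite.to_subtype ((Set.toFinite {-α, 0, α}).subset fun c hc => by
    rcases hc with h | h | h <;> simp [h])

end OrderBook

theorem theorem3 {K : ℕ} (M : OrderBook K) (hM : M.Standing)
    (h_irr : M.IrreducibleAperiodic)
    (h_sign : M.NoSignReversal)
    (h_mom : M.ExpMoments)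
    (h_ins : M.InsertionBound M.fStar M.gStar)
    (h_ins_prop : M.InsertionBound M.aStar M.bStar)
    (r U : ℝ) (hr : 0 < r) (hU : 1 < U)
    (h_size : M.SizeBound U)
    (h_drift : M.NegativeDrift r U)
    (h_bdry : M.BoundaryMoments U)
    (h_jump : M.PriceJumpBound) :
    IsVUniformlyErgodic M.ynorm M.Ychain ∧ IsPositiveHarrisRecurrent M.Ychain := by
  obtain ⟨z₀, B, hz₀, hB⟩ := M.exists_boundaryBounds h_bdry
  obtain ⟨z, δ, L, hzz, hb⟩ :=
    OrderBook.exists_queueBounds h_mom h_ins_prop hr hU h_size h_drift hz₀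
  have hz := hb.one_lt
  obtain ⟨lam, b, hlam, drift⟩ := OrderBook.exists_geometric_drift hM h_sign hU
    (Real.toNNReal_pos.2 hr) hb (hB z hz.le hzz) h_jump
  set V : M.YState → ℝ≥0 := fun x => 1 + OrderBook.Vz U z x.1 with hV
  obtain ⟨q⟩ : Nonempty (Book K) := ⟨M.πinc.support_nonempty.some⟩
  obtain ⟨y₀, hreach⟩ := M.exists_reachable h_irr q
  have hfin : ∀ c : ℝ≥0, {x | V x ≤ c}.Finite := fun c => by
    refine ((OrderBook.finite_Vz_le (K := K) (U := U) hz c).prod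
      (Set.finite_univ (α := Increment M.α))).subset fun x hx => ⟨?_, trivial⟩
    exact le_add_self.trans (show 1 + OrderBook.Vz U z x.1 ≤ c from hx)
  obtain ⟨hharris, π, hπ, ρ, R, hρ0, hρ1, hR⟩ :=
    geometric_ergodicity_of_drift (V := V) (fun x => le_self_add) hlam drift hfin hreach
  refine ⟨⟨fun x => (V x : ℝ), fun x => ?_, ?_, π, hπ, ρ, by exact_mod_cast hρ0,
    by exact_mod_cast hρ1, R, fun x n => ?_⟩, hharris, π, hπ⟩
  · -- there is at least one queue, for otherwise there would be no order flow
    have hne : (Finset.univ : Finset (Fin (2 * K))).Nonempty := by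
      by_contra h
      have h0 := hM.flow_pos x.1
      rw [OrderBook.flow, Finset.not_nonempty_iff_eq_empty.1 h, Finset.sum_empty] at h0
      exact lt_irrefl _ h0
    have hpos : 0 < OrderBook.Vz U z x.1 :=
      Finset.sum_pos (fun i _ => OrderBook.zpow_pos (zero_lt_one.trans hz) _) hne
    have : 1 < V x := lt_add_of_pos_right _ hpos
    exact_mod_cast this
  · rw [tendsto_atTop]
    intro c
    have hc := hfin c.toNNReal
    obtain ⟨m, hm⟩ : ∃ m : ℝ, ∀ x ∈ {x | V x ≤ c.toNNReal}, M.ynorm x ≤ m := by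
      obtain ⟨m, hm⟩ := (hc.image M.ynorm).bddAbove
      exact ⟨m, fun x hx => hm ⟨x, hx, rfl⟩⟩
    filter_upwards [tendsto_comap.eventually (eventually_gt_atTop m)] with x hx
    by_contra hlt
    refine absurd (hm x ?_) (not_le.2 hx)
    exact NNReal.le_toNNReal_of_coe_le (not_le.1 hlt).le
  · rw [wDist_eq_vDist]
    refine (hR x n).trans (le_of_eq ?_)
    rw [← NNReal.coe_pow, ← NNReal.coe_mul, ← NNReal.coe_mul, ENNReal.ofReal_coe_nnreal]
    push_cast
    rfl
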